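/- Let $K$ be an infinite field, $n\ge 2$, $R=K[x_1,\dots,x_n]$ with its standard grading, and $\mathfrak m=(x_1,\dots,x_n)$. For a homogeneous ideal $I$ of $R$ let $I_j$ be the $K$-vector space of forms of degree $j$ in $I$, let $I_{\langle j\rangle}$ be the ideal generated by $I_j$, let $o(I)$ be the least degree of a non-zero element of $I$ (for $I\ne 0$), let $I^{\mathrm{sat}}=\bigcup_k (I:\mathfrak m^k)$, and let $\operatorname{reg}(I)=\max\{j-i:\beta_{ij}(I)\neq 0\}$ (for $I\neq 0$) be the Castelnuovo–Mumford regularity, where $\beta_{ij}(I)=\dim_K\operatorname{Tor}^R_i(I,K)_j$. A homogeneous ideal $I$ is componentwise linear if for every $d\in\mathbb N$ the ideal $I_{\langle d\rangle}$ has a linear resolution, i.e. is zero or satisfies $\operatorname{reg}(I_{\langle d\rangle})=o(I_{\langle d\rangle})$. Let $\mathcal C$ be the set of homogeneous ideals $I$ of $R$ of finite colength (including $I=R$) that are componentwise linear and satisfy $I+(\ell)=\mathfrak m^{o(I)}+(\ell)$ for some non-zero linear form $\ell$. Let $\mathcal A$ be the set of families $\mathcal Q=\{Q_j\}_{j\in\mathbb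 N}$ of homogeneous ideals of $R$ such that $Q_j\subseteq Q_{j+1}$ for all $j$, $Q_j=R$ for all $j\gg 0$, and whenever $Q_j\ne R$ the ideal $Q_j$ is saturated (that is, $Q_j^{\mathrm{sat}}=Q_j$) and $\dim R/Q_j=1$. Here $\mathbb N=\{0,1,2,\dots\}$. Then there are well-defined, mutually inverse maps $$\varphi:\mathcal A\times\mathbb N\to\mathcal C,\qquad \psi:\mathcal C\to\mathcal A\times\mathbb N$$ given by $$\varphi(\mathcal Q,k)=\bigoplus_{j\in\mathbb N}(Q_j)_{\operatorname{reg}(Q_0)+k+j},\qquad \psi(I)=\bigl(\{Q_j(I)\}_{j\in\mathbb N},\ o(I)-\operatorname{reg}(Q_0(I))\bigr),$$ where $Q_j(I)=(I_{\langle o(I)+j\rangle})^{\mathrm{sat}}$. In particular $\varphi(\mathcal Q,k)$ is an ideal of $R$ belonging to $\mathcal C$, the family $\{Q_j(I)\}_j$ belongs to $\mathcal A$, and $o(I)\ge\operatorname{reg}(Q_0(I))$. -/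

import Mathlib

open MvPolynomial

noncomputable section

namespace GradedIdeal

attribute [local instance] MvPolynomial.gradedAlgebra

variable {K : Type*} [Field K] {n : ℕ}

/-- The ideal `I` of `K[x_1, …, x_n]` is homogeneous for the standard grading. -/
def Homog (I : Ideal (MvPolynomial (Fin n) K)) : Prop :=
  I.IsHomogeneous (homogeneousSubmodule (Fin n) K)

/-- `I_j`: the `K`-vector space of the forms of degree `j` in `I`. -/
def component (I : Ideal (MvPolynomial (Fin n) K)) (j : ℕ) :
    Submodule K (MvPolynomial (Fin n) K) :=
  I.restrictScalars K ⊓ homogeneousSubmodule (Fin n) K j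

/-- `I_⟨j⟩`: the ideal generated by the forms of degree `j` in `I`. -/
def componentIdeal (I : Ideal (MvPolynomial (Fin n) K)) (j : ℕ) :
    Ideal (MvPolynomial (Fin n) K) :=
  Ideal.span (component I j : Set (MvPolynomial (Fin n) K))

/-- `o(I)`: the least degree of a non-zero form in the (non-zero, homogeneous) ideal `I`. -/
def initialDegree (I : Ideal (MvPolynomial (Fin n) K)) : ℕ :=
  sInf {d | component I d ≠ ⊥}

/-- The saturation `⋃_k (I : 𝔪^k)` with respect to `𝔪 = (x_1, …, x_n)`.  The ideals `I : 𝔪^k`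
increase with `k`, so their supremum is their union. -/
def saturation (I : Ideal (MvPolynomial (Fin n) K)) : Ideal (MvPolynomial (Fin n) K) :=
  ⨆ k : ℕ, I.colon ((idealOfVars (Fin n) K ^ k : Ideal (MvPolynomial (Fin n) K)) :
    Set (MvPolynomial (Fin n) K))

/-- The Koszul differential of `x_1, …, x_n` over `K[x_1, …, x_n]`.  The function `c` stands for
`∑_S c_S e_S`, and `e_S` is sent to `∑_{a ∈ S} (-1)^{#{b ∈ S : b < a}} x_a e_{S \ {a}}`. -/
def koszulD (K : Type*) [Field K] (n : ℕ) :
    (Finset (Fin n) → MvPolynomial (Fin n) K) →ₗ[K]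
      (Finset (Fin n) → MvPolynomial (Fin n) K) where
  toFun c T := ∑ a ∈ Tᶜ, (-1) ^ (T.filter (fun b => b < a)).card * X a * c (insert a T)
  map_add' c c' := by
    funext T
    simp only [Pi.add_apply, mul_add, Finset.sum_add_distrib]
  map_smul' r c := by
    funext T
    simp only [Pi.smul_apply, mul_smul_comm, Finset.smul_sum, RingHom.id_apply]

/-- The part of homological degree `i` and internal degree `j` of the Koszul complex
`I ⊗ K(x_1, …, x_n)`: the elements `∑_{#S = i} c_S e_S` with each `c_S` in `I`, homogeneous of
degree `j - i` (each `e_S` has degree `i`, so the part is zero if `j < i`). -/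
def koszulChains (I : Ideal (MvPolynomial (Fin n) K)) (i j : ℕ) :
    Submodule K (Finset (Fin n) → MvPolynomial (Fin n) K) :=
  Submodule.pi Set.univ fun S =>
    if S.card = i then
      I.restrictScalars K ⊓ restrictSupport K {m : Fin n →₀ ℕ | m.degree + i = j}
    else ⊥

/-- The cycles in homological degree `i` and internal degree `j`. -/
def koszulCycles (I : Ideal (MvPolynomial (Fin n) K)) (i j : ℕ) :
    Submodule K (Finset (Fin n) → MvPolynomial (Fin n) K) :=
  koszulChains I i j ⊓ LinearMap.ker (koszulD K n)

/-- The boundaries in homological degree `i` and internal degree `j`. -/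
def koszulBoundaries (I : Ideal (MvPolynomial (Fin n) K)) (i j : ℕ) :
    Submodule K (Finset (Fin n) → MvPolynomial (Fin n) K) :=
  (koszulChains I (i + 1) j).map (koszulD K n)

/-- The graded Betti number `β_{ij}(I) = dim_K Tor_i(I, K)_j` of the module `I`, where `Tor` is
computed by the Koszul complex, the minimal graded free resolution of `K`. -/
def gradedBetti (I : Ideal (MvPolynomial (Fin n) K)) (i j : ℕ) : ℕ :=
  Module.finrank K (koszulCycles I i j ⧸ (koszulBoundaries I i j).submoduleOf (koszulCycles I i j))

/-- The Castelnuovo–Mumford regularity `max {j - i : β_{ij}(I) ≠ 0}` of a non-zero homogeneous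
ideal.  (`β_{ij}(I) ≠ 0` forces `i ≤ j`, so the differences are natural numbers.) -/
def regularity (I : Ideal (MvPolynomial (Fin n) K)) : ℕ :=
  sSup {r | ∃ i j : ℕ, gradedBetti I i j ≠ 0 ∧ r + i = j}

/-- The ideal has a linear resolution; the zero ideal has one by convention. -/
def HasLinearResolution (I : Ideal (MvPolynomial (Fin n) K)) : Prop :=
  I = ⊥ ∨ regularity I = initialDegree I

def ComponentwiseLinear (I : Ideal (MvPolynomial (Fin n) K)) : Prop :=
  ∀ d : ℕ, HasLinearResolution (componentIdeal I d)

/-- The class `𝒞`: homogeneous ideals of finite colength that satisfy `I + (ℓ) = 𝔪^{o(I)} + (ℓ)`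
for some non-zero linear form `ℓ`, and that are componentwise linear. -/
def classC (K : Type*) [Field K] (n : ℕ) : Set (Ideal (MvPolynomial (Fin n) K)) :=
  {I | Homog I ∧ Module.Finite K (MvPolynomial (Fin n) K ⧸ I) ∧
    (∃ ℓ : MvPolynomial (Fin n) K, ℓ.IsHomogeneous 1 ∧ ℓ ≠ 0 ∧
      I ⊔ Ideal.span {ℓ} = idealOfVars (Fin n) K ^ initialDegree I ⊔ Ideal.span {ℓ}) ∧
    ComponentwiseLinear I}

/-- The set `𝒜` of the increasing families `(Q_j)_{j ∈ ℕ}` of homogeneous ideals, with `Q_j = R`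
for large `j`, such that every `Q_j ≠ R` is saturated with `dim R / Q_j = 1`. -/
def familiesA (K : Type*) [Field K] (n : ℕ) : Set (ℕ → Ideal (MvPolynomial (Fin n) K)) :=
  {Q | (∀ j, Homog (Q j)) ∧ (∀ j, Q j ≤ Q (j + 1)) ∧ (∃ N, ∀ j, N ≤ j → Q j = ⊤) ∧
    ∀ j, Q j ≠ ⊤ →
      saturation (Q j) = Q j ∧ ringKrullDim (MvPolynomial (Fin n) K ⧸ Q j) = 1}

/-- `Q_j(I)`: the saturation of `I_⟨o(I) + j⟩`. -/
def satFamily (I : Ideal (MvPolynomial (Fin n) K)) (j : ℕ) : Ideal (MvPolynomial (Fin n) K) :=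
  saturation (componentIdeal I (initialDegree I + j))

/-- The vector space `⊕_{j ∈ ℕ} (Q_j)_{d_0 + k + j}` with `d_0 = reg(Q_0)`, inside
`K[x_1, …, x_n]`.  The summands lie in distinct degrees, so their sum is direct. -/
def gradedSum (Q : ℕ → Ideal (MvPolynomial (Fin n) K)) (k : ℕ) :
    Submodule K (MvPolynomial (Fin n) K) :=
  ⨆ j : ℕ, component (Q j) (regularity (Q 0) + k + j)

end GradedIdeal

end

/-!
The Betti numbers of an ideal are computed by the Koszul complex, and regularity at most `r` means
that it has no homology in internal degrees `j > r + i`. Two facts about a homogeneous ideal `Q`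
carry the proof.

If a linear form `l` is a non-zero-divisor modulo `Q` and `Q + (l)` contains some power of `𝔪`, then
`reg Q ≤ r` if and only if `𝔪 ^ r ⊆ Q + (l)`. Such an `l` exists when `Q` is saturated,
`dim R/Q ≤ 1` and `K` is infinite, since then a general linear form avoids the associated primes
of `Q`. Conversely, a saturated `Q ≠ R` with `𝔪 ^ r ⊆ Q + (l)` has `dim R/Q = 1`, because `R/Q` is
finite over `K[l]`.

If `reg Q ≤ d`, then `Q_⟨d⟩` agrees with `Q` in degrees `≥ d`; it has the same saturation as `Q` and
a linear resolution. If moreover a form `f` of degree `≥ d` satisfies `𝔪 f ⊆ Q`, then `f ∈ Q`, as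
otherwise it would give a non-zero class in the top Koszul homology of `R/Q`; hence `Q` agrees with
its saturation in degrees `≥ d`.

For a family `(Q_j)` in `𝒜` and `d ≥ reg Q_0`, the ideal `I = ⊕_j (Q_j)_{d+j}` therefore satisfies
`I_⟨d+j⟩ = (Q_j)_⟨d+j⟩`, whose saturation is `Q_j`. For `I` in `𝒞` with `d = o(I)`, the linear
resolution of `I_⟨d+j⟩` shows that `I` and `Q_j(I)` have the same forms of degree `d + j`, so `I` is
recovered from the family `Q_j(I)`.
-/

noncomputable section

namespace GradedIdeal

attribute [local instance] MvPolynomial.gradedAlgebra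

section Polynomial

variable {σ R : Type*} [CommSemiring R]

lemma isHomogeneous_iff_degree {f : MvPolynomial σ R} {d : ℕ} :
    f.IsHomogeneous d ↔ ∀ m ∈ f.support, m.degree = d := by
  rw [← mem_homogeneousSubmodule, homogeneousSubmodule_eq_finsupp_supported]
  rfl

lemma coe_decompose_eq_homogeneousComponent (f : MvPolynomial σ R) (d : ℕ) :
    (DirectSum.decompose (homogeneousSubmodule σ R) f d : MvPolynomial σ R) =
      homogeneousComponent d f :=
  decomposition.decompose'_apply f d

lemma homogeneousComponent_mul_add {f : MvPolynomial σ R} {d : ℕ} (hf : f.IsHomogeneous d)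
    (g : MvPolynomial σ R) (e : ℕ) :
    homogeneousComponent (d + e) (f * g) = f * homogeneousComponent e g := by
  simpa only [coe_decompose_eq_homogeneousComponent] using
    DirectSum.coe_decompose_mul_add_of_left_mem (homogeneousSubmodule σ R) (b := g) (j := e) hf

lemma homogeneousComponent_mul_of_lt {f : MvPolynomial σ R} {d : ℕ} (hf : f.IsHomogeneous d)
    (g : MvPolynomial σ R) {e : ℕ} (h : e < d) : homogeneousComponent e (f * g) = 0 := by
  simpa only [coe_decompose_eq_homogeneousComponent] using
    DirectSum.coe_decompose_mul_of_left_mem_of_not_le (homogeneousSubmodule σ R) (b := g) hf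
      h.not_ge

lemma isHomogeneous_iff_homogeneousComponent_mem {I : Ideal (MvPolynomial σ R)} :
    I.IsHomogeneous (homogeneousSubmodule σ R) ↔ ∀ f ∈ I, ∀ d, homogeneousComponent d f ∈ I :=
  ⟨fun h _ hf d => homogeneousComponent_mem_of_mem h hf d, fun h d f hf => by
    rw [coe_decompose_eq_homogeneousComponent]
    exact h f hf d⟩

lemma mem_pow_idealOfVars_of_isHomogeneous {f : MvPolynomial σ R} {d e : ℕ}
    (hf : f.IsHomogeneous e) (h : d ≤ e) : f ∈ idealOfVars σ R ^ d :=
  (mem_pow_idealOfVars_iff d f).mpr fun m hm =>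
    h.trans_eq (isHomogeneous_iff_degree.mp hf m hm).symm

lemma pow_idealOfVars_le_iff {I : Ideal (MvPolynomial σ R)} {d : ℕ} :
    idealOfVars σ R ^ d ≤ I ↔ ∀ f : MvPolynomial σ R, f.IsHomogeneous d → f ∈ I := by
  refine ⟨fun h f hf => h (mem_pow_idealOfVars_of_isHomogeneous hf le_rfl), fun h => ?_⟩
  rw [pow_idealOfVars_eq_span, Ideal.span_le]
  rintro _ ⟨m, hm, rfl⟩
  exact h _ (isHomogeneous_monomial _ hm)

lemma isHomogeneous_pow_idealOfVars (d : ℕ) :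
    (idealOfVars σ R ^ d).IsHomogeneous (homogeneousSubmodule σ R) := by
  rw [pow_idealOfVars_eq_span]
  refine Ideal.homogeneous_span _ _ ?_
  rintro _ ⟨m, hm, rfl⟩
  exact ⟨d, isHomogeneous_monomial _ hm⟩

lemma eq_zero_of_isHomogeneous_of_mem_pow {f : MvPolynomial σ R} {d e : ℕ}
    (hf : f.IsHomogeneous e) (hmem : f ∈ idealOfVars σ R ^ d) (h : e < d) : f = 0 := by
  rw [← support_eq_empty, Finset.eq_empty_iff_forall_notMem]
  intro m hm
  have hdeg := isHomogeneous_iff_degree.mp hf m hm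
  have := (mem_pow_idealOfVars_iff d f).mp hmem m hm
  omega

/-- The part of degree `j` of the free module `R[σ](-i)`, that is, the forms of degree `j - i`.
Adding `i` on the left-hand side avoids truncated subtraction: for `j < i` there are no such
forms but `0`. -/
def twistedForms (σ R : Type*) [CommSemiring R] (i j : ℕ) : Submodule R (MvPolynomial σ R) :=
  restrictSupport R {m | m.degree + i = j}

variable {i j : ℕ}

lemma mem_twistedForms {f : MvPolynomial σ R} :
    f ∈ twistedForms σ R i j ↔ ∀ m ∈ f.support, m.degree + i = j :=
  Iff.rfl

lemma mem_twistedForms_add {f : MvPolynomial σ R} {s : ℕ} :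
    f ∈ twistedForms σ R i (i + s) ↔ f.IsHomogeneous s := by
  rw [mem_twistedForms, isHomogeneous_iff_degree]
  exact forall₂_congr fun m _ => by omega

lemma twistedForms_eq_bot (h : j < i) : twistedForms σ R i j = ⊥ := by
  refine (Submodule.eq_bot_iff _).mpr fun f hf => ?_
  rw [← support_eq_empty, Finset.eq_empty_iff_forall_notMem]
  intro m hm
  have := mem_twistedForms.mp hf m hm
  omega

lemma mem_twistedForms_succ_succ {f : MvPolynomial σ R} :
    f ∈ twistedForms σ R (i + 1) (j + 1) ↔ f ∈ twistedForms σ R i j := by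
  simp only [mem_twistedForms, ← add_assoc, Nat.add_right_cancel_iff]

lemma mul_mem_twistedForms {f g : MvPolynomial σ R} {s : ℕ} (hf : f.IsHomogeneous s)
    (hg : g ∈ twistedForms σ R i j) : f * g ∈ twistedForms σ R i (j + s) := by
  rcases lt_or_ge j i with h | h
  · rw [twistedForms_eq_bot h, Submodule.mem_bot] at hg
    rw [hg, mul_zero]
    exact Submodule.zero_mem _
  · obtain ⟨t, rfl⟩ := Nat.exists_eq_add_of_le h
    rw [add_assoc, mem_twistedForms_add, add_comm]
    exact hf.mul (mem_twistedForms_add.mp hg)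

lemma mul_mem_twistedForms_of_succ {f g : MvPolynomial σ R} (hf : f.IsHomogeneous 1)
    (hg : g ∈ twistedForms σ R (i + 1) j) : f * g ∈ twistedForms σ R i j :=
  mem_twistedForms_succ_succ.mp (mul_mem_twistedForms hf hg)

lemma divMonomial_single_mem_twistedForms {f : MvPolynomial σ R} (a : σ)
    (hf : f ∈ twistedForms σ R i j) :
    f.divMonomial (Finsupp.single a 1) ∈ twistedForms σ R (i + 1) j := by
  refine mem_twistedForms.mpr fun m hm => ?_
  rw [mem_support_iff, coeff_divMonomial] at hm
  have := mem_twistedForms.mp hf _ (mem_support_iff.mpr hm)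
  rw [map_add, Finsupp.degree_single] at this
  omega

lemma exists_twistedForms_of_mem_sup_span {Q : Ideal (MvPolynomial σ R)}
    (hQ : Q.IsHomogeneous (homogeneousSubmodule σ R)) {l f : MvPolynomial σ R}
    (hl : l.IsHomogeneous 1) (hf : f ∈ twistedForms σ R i (j + 1)) (h : f ∈ Q ⊔ Ideal.span {l}) :
    ∃ q ∈ Q, q ∈ twistedForms σ R i (j + 1) ∧ ∃ g ∈ twistedForms σ R i j, q + l * g = f := by
  rcases lt_or_ge (j + 1) i with hij | hij
  · rw [twistedForms_eq_bot hij, Submodule.mem_bot] at hf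
    exact ⟨0, Q.zero_mem, Submodule.zero_mem _, 0, Submodule.zero_mem _, by simp [hf]⟩
  obtain ⟨s, hs⟩ := Nat.exists_eq_add_of_le hij
  rw [hs] at hf ⊢
  obtain ⟨q, hq, y, hy, rfl⟩ := Submodule.mem_sup.mp h
  obtain ⟨g, rfl⟩ := Ideal.mem_span_singleton.mp hy
  have hcomp := homogeneousComponent_eq_self (mem_twistedForms_add.mp hf)
  rw [map_add] at hcomp
  refine ⟨homogeneousComponent s q, isHomogeneous_iff_homogeneousComponent_mem.mp hQ q hq s,
    mem_twistedForms_add.mpr (homogeneousComponent_isHomogeneous s q), ?_⟩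
  rcases s with _ | s
  · refine ⟨0, Submodule.zero_mem _, ?_⟩
    rw [← hcomp, homogeneousComponent_mul_of_lt hl g zero_lt_one, mul_zero]
  · obtain rfl : j = i + s := by omega
    refine ⟨homogeneousComponent s g,
      mem_twistedForms_add.mpr (homogeneousComponent_isHomogeneous s g), ?_⟩
    rw [← hcomp, add_comm s 1, homogeneousComponent_mul_add hl]

end Polynomial

section Division

variable {σ R : Type*} [CommSemiring R]

lemma sum_divMonomial {ι : Type*} (s : Finset ι) (f : ι → MvPolynomial σ R) (m : σ →₀ ℕ) :
    (∑ i ∈ s, f i).divMonomial m = ∑ i ∈ s, (f i).divMonomial m := by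
  ext m'
  simp only [coeff_divMonomial, coeff_sum]

lemma C_mul_divMonomial (r : R) (f : MvPolynomial σ R) (m : σ →₀ ℕ) :
    (C r * f).divMonomial m = C r * f.divMonomial m := by
  ext m'
  simp only [coeff_divMonomial, coeff_C_mul]

lemma X_mul_divMonomial_of_ne {a b : σ} (h : b ≠ a) (f : MvPolynomial σ R) :
    (X b * f).divMonomial (Finsupp.single a 1) = X b * f.divMonomial (Finsupp.single a 1) := by
  classical
  ext m
  have hsupport : b ∈ (Finsupp.single a 1 + m).support ↔ b ∈ m.support := by simp [h.symm]
  rw [coeff_divMonomial, coeff_X_mul', coeff_X_mul']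
  by_cases hb : b ∈ m.support
  · have hle : Finsupp.single b 1 ≤ m :=
      Finsupp.single_le_iff.mpr (Nat.one_le_iff_ne_zero.mpr (Finsupp.mem_support_iff.mp hb))
    rw [if_pos (hsupport.mpr hb), if_pos hb, coeff_divMonomial, add_tsub_assoc_of_le hle]
  · rw [if_neg (mt hsupport.mp hb), if_neg hb]

lemma mem_support_modMonomial_single {f : MvPolynomial σ R} {a : σ} {m : σ →₀ ℕ}
    (hm : m ∈ (f.modMonomial (Finsupp.single a 1)).support) : m ∈ f.support ∧ m a = 0 := by
  rw [mem_support_iff] at hm ⊢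
  have hle : ¬ Finsupp.single a 1 ≤ m := fun h => hm (coeff_modMonomial_of_le _ h)
  rw [coeff_modMonomial_of_not_le _ hle] at hm
  rw [Finsupp.single_le_iff] at hle
  exact ⟨hm, by omega⟩

end Division

section Koszul

variable {K : Type*} [Field K] {n : ℕ}

/-- The sign with which `x_a e_T` occurs in the Koszul differential of `e_{T ∪ {a}}`; it is also
the sign of `e_a ∧ e_{T \ {a}}` with respect to `e_T`. -/
def koszulSign (K : Type*) [Field K] {n : ℕ} (T : Finset (Fin n)) (a : Fin n) :
    MvPolynomial (Fin n) K :=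
  (-1) ^ (T.filter (fun b => b < a)).card

lemma koszulD_apply (c : Finset (Fin n) → MvPolynomial (Fin n) K) (T : Finset (Fin n)) :
    koszulD K n c T = ∑ a ∈ Tᶜ, koszulSign K T a * X a * c (insert a T) := rfl

lemma koszulSign_eq_C (T : Finset (Fin n)) (a : Fin n) :
    koszulSign K T a = C ((-1) ^ (T.filter (fun b => b < a)).card) := by
  simp [koszulSign]

lemma koszulSign_mul_self (T : Finset (Fin n)) (a : Fin n) :
    koszulSign K T a * koszulSign K T a = 1 := by
  simp [koszulSign, ← mul_pow]

lemma koszulSign_isHomogeneous (T : Finset (Fin n)) (a : Fin n) :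
    (koszulSign K T a).IsHomogeneous 0 :=
  koszulSign_eq_C (K := K) T a ▸ isHomogeneous_C _ _

lemma koszulSign_insert {T : Finset (Fin n)} {a b : Fin n} (hb : b ∉ T) :
    koszulSign K (insert b T) a = if b < a then -koszulSign K T a else koszulSign K T a := by
  unfold koszulSign
  rw [Finset.filter_insert]
  split_ifs with h
  · rw [Finset.card_insert_of_notMem (by simp [hb]), pow_succ, mul_neg_one]
  · rfl

lemma koszulSign_erase {T : Finset (Fin n)} {a b : Fin n} (ha : a ∈ T) :
    koszulSign K (T.erase a) b = if a < b then -koszulSign K T b else koszulSign K T b := by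
  conv_rhs => rw [← Finset.insert_erase ha, koszulSign_insert (Finset.notMem_erase a T)]
  split_ifs <;> simp

lemma koszulD_univ_erase (c : Finset (Fin n) → MvPolynomial (Fin n) K) (a : Fin n) :
    koszulD K n c (Finset.univ.erase a) = koszulSign K Finset.univ a * X a * c Finset.univ := by
  simp [koszulD_apply, Finset.compl_erase, koszulSign_erase]

lemma koszulD_empty (c : Finset (Fin n) → MvPolynomial (Fin n) K) :
    koszulD K n c ∅ = ∑ a, X a * c {a} := by
  simp [koszulD_apply, koszulSign]

lemma koszulD_smul (f : MvPolynomial (Fin n) K) (c : Finset (Fin n) → MvPolynomial (Fin n) K) :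
    koszulD K n (f • c) = f • koszulD K n c := by
  funext T
  simp only [koszulD_apply, Pi.smul_apply, smul_eq_mul, Finset.mul_sum]
  exact Finset.sum_congr rfl fun a _ => by ring

lemma koszulD_koszulD (c : Finset (Fin n) → MvPolynomial (Fin n) K) :
    koszulD K n (koszulD K n c) = 0 := by
  funext T
  simp only [koszulD_apply, Finset.mul_sum, Pi.zero_apply]
  rw [Finset.sum_sigma']
  refine Finset.sum_involution (fun p _ => ⟨p.2, p.1⟩) ?cancel ?distinct ?mem fun _ _ => rfl
  case cancel =>
    rintro ⟨a, b⟩ h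
    simp only [Finset.mem_sigma, Finset.mem_compl, Finset.mem_insert, not_or] at h
    obtain ⟨ha, hba, hb⟩ := h
    dsimp only
    rw [koszulSign_insert ha, koszulSign_insert hb, Finset.insert_comm b a]
    rcases lt_or_gt_of_ne hba with h | h
    · rw [if_neg h.not_gt, if_pos h]; ring
    · rw [if_pos h, if_neg h.not_gt]; ring
  case distinct =>
    rintro ⟨a, b⟩ h _ h'
    simp only [Finset.mem_sigma, Finset.mem_compl, Finset.mem_insert, not_or] at h
    simp only [Sigma.mk.injEq, heq_eq_eq] at h'
    exact h.2.1 h'.1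
  case mem =>
    rintro ⟨a, b⟩ h
    simp only [Finset.mem_sigma, Finset.mem_compl, Finset.mem_insert, not_or] at h ⊢
    exact ⟨h.2.2, Ne.symm h.2.1, h.1⟩

/-- Exterior multiplication by `e_a` on the left on the Koszul complex: it is a homotopy between
multiplication by `x_a` and zero. -/
def koszulWedge (a : Fin n) : (Finset (Fin n) → MvPolynomial (Fin n) K) →ₗ[MvPolynomial (Fin n) K]
    (Finset (Fin n) → MvPolynomial (Fin n) K) where
  toFun c T := if a ∈ T then koszulSign K T a * c (T.erase a) else 0
  map_add' c c' := by
    funext T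
    simp only [Pi.add_apply]
    split_ifs <;> ring
  map_smul' f c := by
    funext T
    simp only [Pi.smul_apply, smul_eq_mul, RingHom.id_apply]
    split_ifs <;> ring

lemma koszulWedge_apply (a : Fin n) (c : Finset (Fin n) → MvPolynomial (Fin n) K)
    (T : Finset (Fin n)) :
    koszulWedge a c T = if a ∈ T then koszulSign K T a * c (T.erase a) else 0 := rfl

lemma koszulWedge_apply_of_mem {a : Fin n} {T : Finset (Fin n)} (ha : a ∈ T)
    (c : Finset (Fin n) → MvPolynomial (Fin n) K) :
    koszulWedge a c T = koszulSign K T a * c (T.erase a) := if_pos ha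

lemma koszulWedge_apply_of_notMem {a : Fin n} {T : Finset (Fin n)} (ha : a ∉ T)
    (c : Finset (Fin n) → MvPolynomial (Fin n) K) : koszulWedge a c T = 0 := if_neg ha

lemma koszulD_apply_erase {T : Finset (Fin n)} {a : Fin n} (ha : a ∈ T)
    (c : Finset (Fin n) → MvPolynomial (Fin n) K) :
    koszulD K n c (T.erase a) = koszulSign K T a * X a * c T +
      ∑ b ∈ Tᶜ, koszulSign K (T.erase a) b * X b * c (insert b (T.erase a)) := by
  rw [koszulD_apply, Finset.compl_erase, Finset.sum_insert (by simpa using ha),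
    Finset.insert_erase ha, koszulSign_erase ha, if_neg (lt_irrefl a)]

lemma koszulD_koszulWedge_add (a : Fin n) (c : Finset (Fin n) → MvPolynomial (Fin n) K) :
    koszulD K n (koszulWedge a c) + koszulWedge a (koszulD K n c) =
      (X a : MvPolynomial (Fin n) K) • c := by
  funext T
  rw [Pi.add_apply, Pi.smul_apply, smul_eq_mul]
  have hsign := koszulSign_mul_self (K := K) T a
  by_cases ha : a ∈ T
  · have hcancel : koszulD K n (koszulWedge a c) T + koszulSign K T a *
        ∑ b ∈ Tᶜ, koszulSign K (T.erase a) b * X b * c (insert b (T.erase a)) = 0 := by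
      rw [koszulD_apply, Finset.mul_sum, ← Finset.sum_add_distrib]
      refine Finset.sum_eq_zero fun b hb => ?_
      have hbT : b ∉ T := Finset.mem_compl.mp hb
      have hab : a ≠ b := fun h => hbT (h ▸ ha)
      rw [koszulWedge_apply_of_mem (Finset.mem_insert_of_mem ha), koszulSign_erase ha,
        koszulSign_insert hbT, Finset.erase_insert_of_ne hab.symm]
      rcases lt_or_gt_of_ne hab with h | h
      · rw [if_neg h.not_gt, if_pos h]; ring
      · rw [if_pos h, if_neg h.not_gt]; ring
    rw [koszulWedge_apply_of_mem ha, koszulD_apply_erase ha]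
    linear_combination hcancel + X a * c T * hsign
  · rw [koszulWedge_apply_of_notMem ha, add_zero, koszulD_apply,
      Finset.sum_eq_single_of_mem a (by simpa using ha), koszulWedge_apply_of_mem (by simp),
      Finset.erase_insert ha, koszulSign_insert ha, if_neg (lt_irrefl a)]
    · linear_combination X a * c T * hsign
    · intro b _ hba
      rw [koszulWedge_apply_of_notMem (by simp [ha, hba.symm]), mul_zero]

section Chains

variable {I J : Ideal (MvPolynomial (Fin n) K)} {i j : ℕ}
  {c : Finset (Fin n) → MvPolynomial (Fin n) K}

lemma mem_koszulChains : c ∈ koszulChains I i j ↔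
    ∀ S, c S ∈ I ∧ c S ∈ twistedForms (Fin n) K i j ∧ (S.card ≠ i → c S = 0) := by
  simp only [koszulChains, Submodule.mem_pi, Set.mem_univ, true_imp_iff]
  refine forall_congr' fun S => ?_
  split_ifs with hS
  · simp [hS, twistedForms]
  · rw [Submodule.mem_bot]
    refine ⟨fun h => ?_, fun h => h.2.2 hS⟩
    rw [h]
    exact ⟨I.zero_mem, Submodule.zero_mem _, fun _ => rfl⟩

lemma koszulChains_mono (h : I ≤ J) : koszulChains I i j ≤ koszulChains J i j := fun _ hc =>
  mem_koszulChains.mpr fun S => (mem_koszulChains.mp hc S).imp_left (@h _)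

lemma mem_koszulChains_of_top (hc : c ∈ koszulChains ⊤ i j) (hI : ∀ S, c S ∈ I) :
    c ∈ koszulChains I i j :=
  mem_koszulChains.mpr fun S => ⟨hI S, (mem_koszulChains.mp hc S).2⟩

lemma single_mem_koszulChains {S : Finset (Fin n)} {f : MvPolynomial (Fin n) K} (hI : f ∈ I)
    (hf : f ∈ twistedForms (Fin n) K S.card j) : Pi.single S f ∈ koszulChains I S.card j := by
  refine mem_koszulChains.mpr fun T => ?_
  obtain rfl | h := eq_or_ne T S
  · rw [Pi.single_eq_same]
    exact ⟨hI, hf, fun h => absurd rfl h⟩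
  · rw [Pi.single_eq_of_ne h]
    exact ⟨I.zero_mem, Submodule.zero_mem _, fun _ => rfl⟩

lemma smul_mem_koszulChains {f : MvPolynomial (Fin n) K} {s : ℕ} (hf : f.IsHomogeneous s)
    (hc : c ∈ koszulChains I i j) : f • c ∈ koszulChains I i (j + s) :=
  mem_koszulChains.mpr fun S =>
    have ⟨hI, hdeg, hzero⟩ := mem_koszulChains.mp hc S
    ⟨I.mul_mem_left f hI, mul_mem_twistedForms hf hdeg,
      fun hS => by rw [Pi.smul_apply, hzero hS, smul_zero]⟩

lemma koszulD_mem_koszulChains (hc : c ∈ koszulChains I (i + 1) j) :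
    koszulD K n c ∈ koszulChains I i j := by
  rw [mem_koszulChains] at hc ⊢
  intro T
  rw [koszulD_apply]
  refine ⟨I.sum_mem fun a _ => I.mul_mem_left _ (hc _).1, Submodule.sum_mem _ fun a _ => ?_,
    fun hT => Finset.sum_eq_zero fun a ha => ?_⟩
  · exact mul_mem_twistedForms_of_succ
      ((koszulSign_isHomogeneous T a).mul (isHomogeneous_X K a)) (hc _).2.1
  · rw [(hc _).2.2, mul_zero]
    rw [Finset.card_insert_of_notMem (by simpa using ha)]
    omega

lemma koszulD_eq_zero_of_mem_koszulChains_zero (hc : c ∈ koszulChains I 0 j) :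
    koszulD K n c = 0 :=
  funext fun T => Finset.sum_eq_zero fun a _ => by
    rw [(mem_koszulChains.mp hc _).2.2 (Finset.card_ne_zero_of_mem (Finset.mem_insert_self a T)),
      mul_zero]

lemma koszulWedge_mem_koszulChains (a : Fin n) (hI : ∀ S, c S ∈ I)
    (hdeg : ∀ S, c S ∈ twistedForms (Fin n) K (i + 1) j) (hzero : ∀ S, S.card ≠ i → c S = 0) :
    koszulWedge a c ∈ koszulChains I (i + 1) j := by
  refine mem_koszulChains.mpr fun T => ?_
  rw [koszulWedge_apply]
  split_ifs with ha
  · refine ⟨I.mul_mem_left _ (hI _), mul_mem_twistedForms (koszulSign_isHomogeneous T a) (hdeg _),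
      fun hT => ?_⟩
    rw [hzero, mul_zero]
    have := Finset.card_erase_add_one ha
    omega
  · exact ⟨I.zero_mem, Submodule.zero_mem _, fun _ => rfl⟩

end Chains

lemma exists_koszul_homotopy {l : MvPolynomial (Fin n) K} (hl : l.IsHomogeneous 1) :
    ∃ h : (Finset (Fin n) → MvPolynomial (Fin n) K) →ₗ[MvPolynomial (Fin n) K]
        (Finset (Fin n) → MvPolynomial (Fin n) K),
      (∀ c, koszulD K n (h c) + h (koszulD K n c) = l • c) ∧
      ∀ I i j, ∀ c ∈ koszulChains I i j, h c ∈ koszulChains I (i + 1) (j + 1) := by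
  rw [← mem_homogeneousSubmodule, homogeneousSubmodule_one_eq_span_X] at hl
  induction hl using Submodule.span_induction with
  | mem x hx =>
    obtain ⟨a, rfl⟩ := hx
    refine ⟨koszulWedge a, koszulD_koszulWedge_add a, fun I i j c hc => ?_⟩
    rw [mem_koszulChains] at hc
    exact koszulWedge_mem_koszulChains a (fun S => (hc S).1)
      (fun S => mem_twistedForms_succ_succ.mpr (hc S).2.1) fun S => (hc S).2.2
  | zero => exact ⟨0, by simp, fun I i j c _ => Submodule.zero_mem _⟩
  | add x y _ _ hx hy =>
    obtain ⟨h, hd, hmem⟩ := hx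
    obtain ⟨h', hd', hmem'⟩ := hy
    refine ⟨h + h', fun c => ?_, fun I i j c hc =>
      Submodule.add_mem _ (hmem I i j c hc) (hmem' I i j c hc)⟩
    rw [add_smul, ← hd, ← hd', LinearMap.add_apply, LinearMap.add_apply, map_add]
    abel
  | smul r x _ hx =>
    obtain ⟨h, hd, hmem⟩ := hx
    refine ⟨(C r : MvPolynomial (Fin n) K) • h, fun c => ?_, fun I i j c hc =>
      smul_mem_koszulChains (s := 0) (isHomogeneous_C _ r) (hmem I i j c hc)⟩
    rw [LinearMap.smul_apply, LinearMap.smul_apply, koszulD_smul, ← smul_add, hd, smul_smul,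
      smul_eq_C_mul]

end Koszul

section Exactness

variable {K : Type*} [Field K] {n : ℕ} {i j : ℕ}

/-- The Koszul chain obtained by killing `x_a` and `e_a`. -/
def eliminateVariable (a : Fin n) (c : Finset (Fin n) → MvPolynomial (Fin n) K) :
    Finset (Fin n) → MvPolynomial (Fin n) K :=
  fun S => if a ∈ S then 0 else (c S).modMonomial (Finsupp.single a 1)

/-- The homotopy between the identity and `eliminateVariable a` on the Koszul complex: the
quotient by `x_a`, wedged with `e_a`. -/
def eliminationHomotopy (a : Fin n) (c : Finset (Fin n) → MvPolynomial (Fin n) K) :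
    Finset (Fin n) → MvPolynomial (Fin n) K :=
  koszulWedge a fun S => (c S).divMonomial (Finsupp.single a 1)

/-- Neither the variables `x_a` nor the exterior generators `e_a` with `a ∈ A` occur in the
Koszul chain `c`. -/
def AvoidsVariables (A : Finset (Fin n)) (c : Finset (Fin n) → MvPolynomial (Fin n) K) : Prop :=
  ∀ S, ∀ m ∈ (c S).support, ∀ a ∈ A, a ∉ S ∧ m a = 0

lemma divMonomial_koszulD_of_notMem {a : Fin n} {T : Finset (Fin n)} (ha : a ∉ T)
    (c : Finset (Fin n) → MvPolynomial (Fin n) K) :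
    (koszulD K n c T).divMonomial (Finsupp.single a 1) =
      koszulD K n (fun S => (c S).divMonomial (Finsupp.single a 1)) T +
        koszulSign K T a * (c (insert a T)).modMonomial (Finsupp.single a 1) := by
  have hterm : ∀ b ∈ Tᶜ, (koszulSign K T b * X b * c (insert b T)).divMonomial
      (Finsupp.single a 1) = koszulSign K T b * X b *
        (c (insert b T)).divMonomial (Finsupp.single a 1) + if b = a then
          koszulSign K T a * (c (insert a T)).modMonomial (Finsupp.single a 1) else 0 := by
    intro b _
    rw [mul_assoc, koszulSign_eq_C, C_mul_divMonomial, ← koszulSign_eq_C]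
    split_ifs with hba
    · subst hba
      rw [X_mul_divMonomial]
      linear_combination -koszulSign K T b *
        divMonomial_add_modMonomial_single (c (insert b T)) b
    · rw [X_mul_divMonomial_of_ne hba, mul_assoc, add_zero]
  rw [koszulD_apply, sum_divMonomial, Finset.sum_congr rfl hterm, Finset.sum_add_distrib,
    Finset.sum_ite_eq' _ a, if_pos (Finset.mem_compl.mpr ha), koszulD_apply]

lemma koszulD_eliminationHomotopy_add (a : Fin n)
    (c : Finset (Fin n) → MvPolynomial (Fin n) K) :
    koszulD K n (eliminationHomotopy a c) + eliminationHomotopy a (koszulD K n c) =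
      c - eliminateVariable a c := by
  funext S
  have hhomotopy := congrFun
    (koszulD_koszulWedge_add a fun T => (c T).divMonomial (Finsupp.single a 1)) S
  have hdivmod := divMonomial_add_modMonomial_single (c S) a
  simp only [Pi.add_apply, Pi.smul_apply, smul_eq_mul, Pi.sub_apply, eliminationHomotopy,
    eliminateVariable] at hhomotopy ⊢
  by_cases ha : a ∈ S
  · rw [koszulWedge_apply_of_mem ha] at hhomotopy ⊢
    rw [if_pos ha, divMonomial_koszulD_of_notMem (Finset.notMem_erase a S),
      Finset.insert_erase ha, koszulSign_erase ha, if_neg (lt_irrefl a)]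
    linear_combination hhomotopy + hdivmod + (c S).modMonomial (Finsupp.single a 1) *
      koszulSign_mul_self (K := K) S a
  · rw [koszulWedge_apply_of_notMem ha] at hhomotopy ⊢
    rw [if_neg ha]
    linear_combination hhomotopy + hdivmod

lemma eliminationHomotopy_mem_koszulChains (a : Fin n)
    {c : Finset (Fin n) → MvPolynomial (Fin n) K} (hc : c ∈ koszulChains ⊤ i j) :
    eliminationHomotopy a c ∈ koszulChains ⊤ (i + 1) j := by
  rw [mem_koszulChains] at hc
  refine koszulWedge_mem_koszulChains a (fun _ => Submodule.mem_top)
    (fun S => divMonomial_single_mem_twistedForms a (hc S).2.1) fun S hS => ?_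
  rw [(hc S).2.2 hS, zero_divMonomial]

lemma AvoidsVariables.eliminateVariable {A : Finset (Fin n)}
    {c : Finset (Fin n) → MvPolynomial (Fin n) K} (hc : AvoidsVariables A c) (a : Fin n) :
    AvoidsVariables (insert a A) (eliminateVariable a c) := by
  intro S m hm b hb
  rw [GradedIdeal.eliminateVariable] at hm
  split_ifs at hm with ha
  · simp at hm
  obtain ⟨hmc, hma⟩ := mem_support_modMonomial_single hm
  obtain rfl | hb := Finset.mem_insert.mp hb
  exacts [⟨ha, hma⟩, hc S m hmc b hb]

lemma exists_avoidsVariables_sub_mem_koszulBoundaries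
    {c : Finset (Fin n) → MvPolynomial (Fin n) K} (hc : c ∈ koszulCycles ⊤ i j)
    (A : Finset (Fin n)) :
    ∃ w ∈ koszulCycles ⊤ i j, AvoidsVariables A w ∧ c - w ∈ koszulBoundaries ⊤ i j := by
  induction A using Finset.induction_on with
  | empty =>
    exact ⟨c, hc, fun _ _ _ _ h => absurd h (Finset.notMem_empty _), by simp⟩
  | insert a A _ ih =>
    obtain ⟨w, hw, havoid, hbound⟩ := ih
    obtain ⟨hchain, hker⟩ := Submodule.mem_inf.mp hw
    have hhomotopy := koszulD_eliminationHomotopy_add a w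
    have hzero : eliminationHomotopy a (koszulD K n w) = 0 := by
      rw [LinearMap.mem_ker.mp hker]
      exact (congrArg (koszulWedge a) (funext fun _ => zero_divMonomial _)).trans (map_zero _)
    rw [hzero, add_zero] at hhomotopy
    have hmem := eliminationHomotopy_mem_koszulChains a hchain
    have helim : eliminateVariable a w = w - koszulD K n (eliminationHomotopy a w) := by
      rw [hhomotopy, sub_sub_cancel]
    refine ⟨eliminateVariable a w, ?_, havoid.eliminateVariable a, ?_⟩
    · rw [helim]
      refine Submodule.sub_mem _ hw ⟨koszulD_mem_koszulChains hmem, ?_⟩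
      exact LinearMap.mem_ker.mpr (koszulD_koszulD _)
    · rw [helim, ← sub_add]
      exact Submodule.add_mem _ hbound ⟨_, hmem, rfl⟩

lemma AvoidsVariables.eq_zero {c : Finset (Fin n) → MvPolynomial (Fin n) K}
    (h : AvoidsVariables Finset.univ c) (hc : c ∈ koszulChains ⊤ i j) (hj : j ≠ 0) : c = 0 := by
  funext S
  rw [Pi.zero_apply, ← support_eq_empty, Finset.eq_empty_iff_forall_notMem]
  intro m hm
  obtain ⟨-, hdeg, hzero⟩ := mem_koszulChains.mp hc S
  have hS : S = ∅ := Finset.eq_empty_of_forall_notMem fun a => (h S m hm a (Finset.mem_univ a)).1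
  have hm0 : m = 0 := Finsupp.ext fun a => (h S m hm a (Finset.mem_univ a)).2
  have hi : i = 0 := by
    by_contra hi
    simp [hzero (by simpa [hS] using Ne.symm hi)] at hm
  exact hj (by simpa [hm0, hi] using (mem_twistedForms.mp hdeg m hm).symm)

theorem koszulCycles_top_le_koszulBoundaries (hj : j ≠ 0) :
    koszulCycles (⊤ : Ideal (MvPolynomial (Fin n) K)) i j ≤ koszulBoundaries ⊤ i j := by
  intro c hc
  obtain ⟨w, hw, havoid, hbound⟩ :=
    exists_avoidsVariables_sub_mem_koszulBoundaries hc Finset.univ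
  rwa [havoid.eq_zero (Submodule.mem_inf.mp hw).1 hj, sub_zero] at hbound

end Exactness

section Homogeneous

variable {K : Type*} [Field K] {n : ℕ} {I J : Ideal (MvPolynomial (Fin n) K)} {d e : ℕ}
  {f : MvPolynomial (Fin n) K}

lemma mem_component : f ∈ component I d ↔ f ∈ I ∧ f.IsHomogeneous d := by
  rw [component, Submodule.mem_inf, Submodule.restrictScalars_mem, mem_homogeneousSubmodule]

lemma component_mono (h : I ≤ J) (d : ℕ) : component I d ≤ component J d := fun _ hf =>
  mem_component.mpr ((mem_component.mp hf).imp_left (@h _))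

lemma component_bot (d : ℕ) : component (⊥ : Ideal (MvPolynomial (Fin n) K)) d = ⊥ :=
  (Submodule.eq_bot_iff _).mpr fun _ hf => (mem_component.mp hf).1

lemma component_eq_bot_of_le_pow (h : I ≤ idealOfVars (Fin n) K ^ d) (he : e < d) :
    component I e = ⊥ :=
  (Submodule.eq_bot_iff _).mpr fun _ hf =>
    eq_zero_of_isHomogeneous_of_mem_pow (mem_component.mp hf).2 (h (mem_component.mp hf).1) he

lemma component_add_ne_bot [NeZero n] (h : component I d ≠ ⊥) (j : ℕ) :
    component I (d + j) ≠ ⊥ := by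
  obtain ⟨f, hf, hf0⟩ := Submodule.exists_mem_ne_zero_of_ne_bot h
  obtain ⟨hfI, hfd⟩ := mem_component.mp hf
  refine Submodule.ne_bot_iff _ |>.mpr ⟨f * X 0 ^ j, mem_component.mpr ⟨I.mul_mem_right _ hfI, ?_⟩,
    mul_ne_zero hf0 (pow_ne_zero j (X_ne_zero 0))⟩
  exact hfd.mul (isHomogeneous_X_pow 0 j)

lemma Homog.homogeneousComponent_mem_component (hI : Homog I) (hf : f ∈ I) (d : ℕ) :
    homogeneousComponent d f ∈ component I d :=
  mem_component.mpr ⟨homogeneousComponent_mem_of_mem hI hf d,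
    homogeneousComponent_isHomogeneous d f⟩

lemma Homog.le_of_component_le (hI : Homog I) (h : ∀ d, component I d ≤ component J d) :
    I ≤ J := fun f hf => by
  rw [← sum_homogeneousComponent f]
  exact J.sum_mem fun d _ =>
    (mem_component.mp (h d (hI.homogeneousComponent_mem_component hf d))).1

lemma Homog.eq_of_component_eq (hI : Homog I) (hJ : Homog J)
    (h : ∀ d, component I d = component J d) : I = J :=
  le_antisymm (hI.le_of_component_le fun d => (h d).le)
    (hJ.le_of_component_le fun d => (h d).ge)

lemma homog_span_singleton (hf : f.IsHomogeneous d) : Homog (Ideal.span {f}) :=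
  Ideal.homogeneous_span _ _ fun _ hg => ⟨d, hg ▸ hf⟩

lemma componentIdeal_le (I : Ideal (MvPolynomial (Fin n) K)) (d : ℕ) : componentIdeal I d ≤ I :=
  Ideal.span_le.mpr fun _ hf => (mem_component.mp hf).1

lemma componentIdeal_le_pow (I : Ideal (MvPolynomial (Fin n) K)) (d : ℕ) :
    componentIdeal I d ≤ idealOfVars (Fin n) K ^ d :=
  Ideal.span_le.mpr fun _ hf => mem_pow_idealOfVars_of_isHomogeneous (mem_component.mp hf).2 le_rfl

lemma homog_componentIdeal (I : Ideal (MvPolynomial (Fin n) K)) (d : ℕ) :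
    Homog (componentIdeal I d) :=
  Ideal.homogeneous_span _ _ fun _ hf => ⟨d, (mem_component.mp hf).2⟩

lemma component_componentIdeal_self (I : Ideal (MvPolynomial (Fin n) K)) (d : ℕ) :
    component (componentIdeal I d) d = component I d :=
  le_antisymm (component_mono (componentIdeal_le I d) d) fun _ hf =>
    mem_component.mpr ⟨Ideal.subset_span hf, (mem_component.mp hf).2⟩

lemma componentIdeal_eq_bot (h : component I d = ⊥) : componentIdeal I d = ⊥ := by
  rw [componentIdeal, h, Submodule.bot_coe, Ideal.span_singleton_eq_bot]

lemma initialDegree_eq (h : I ≤ idealOfVars (Fin n) K ^ d) (hd : component I d ≠ ⊥) :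
    initialDegree I = d := by
  refine le_antisymm (Nat.sInf_le hd) (le_csInf ⟨d, hd⟩ fun e he => ?_)
  by_contra! hlt
  exact he (component_eq_bot_of_le_pow h hlt)

lemma eq_top_of_component_zero_ne_bot (h : component I 0 ≠ ⊥) : I = ⊤ := by
  obtain ⟨f, hf, hf0⟩ := Submodule.exists_mem_ne_zero_of_ne_bot h
  obtain ⟨hfI, hfd⟩ := mem_component.mp hf
  rw [← mem_homogeneousSubmodule, homogeneousSubmodule_zero, Submodule.mem_one] at hfd
  obtain ⟨x, rfl⟩ := hfd
  exact Ideal.eq_top_of_isUnit_mem _ hfI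
    ((IsUnit.mk0 x (by rintro rfl; exact hf0 (map_zero _))).map _)

lemma Homog.le_idealOfVars (hI : Homog I) (h : I ≠ ⊤) : I ≤ idealOfVars (Fin n) K ^ 1 := by
  refine hI.le_of_component_le fun d => ?_
  rcases Nat.eq_zero_or_pos d with rfl | hd
  · rw [not_not.mp fun h0 => h (eq_top_of_component_zero_ne_bot h0)]
    exact bot_le
  · exact fun f hf => mem_component.mpr
      ⟨mem_pow_idealOfVars_of_isHomogeneous (mem_component.mp hf).2 hd, (mem_component.mp hf).2⟩

end Homogeneous

section Saturation

variable {K : Type*} [Field K] {n : ℕ} {I J : Ideal (MvPolynomial (Fin n) K)} {d e k : ℕ}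
  {f : MvPolynomial (Fin n) K}

lemma mem_colon_pow_idealOfVars :
    f ∈ I.colon (idealOfVars (Fin n) K ^ k : Ideal (MvPolynomial (Fin n) K)) ↔
      ∀ u : MvPolynomial (Fin n) K, u.IsHomogeneous k → u * f ∈ I := by
  have hcolon : ∀ u, u ∈ I.colon {f} ↔ u * f ∈ I := fun u => Submodule.mem_colon_singleton
  simp only [← hcolon, ← pow_idealOfVars_le_iff, SetLike.le_def]
  simp only [hcolon, Submodule.mem_colon, SetLike.mem_coe, smul_eq_mul, mul_comm f]

lemma monotone_colon_pow_idealOfVars (I : Ideal (MvPolynomial (Fin n) K)) :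
    Monotone fun k => I.colon (idealOfVars (Fin n) K ^ k : Ideal (MvPolynomial (Fin n) K)) :=
  fun _ _ hk => Submodule.colon_mono le_rfl (Ideal.pow_le_pow_right hk)

lemma mem_saturation : f ∈ saturation I ↔
    ∃ k, ∀ u : MvPolynomial (Fin n) K, u.IsHomogeneous k → u * f ∈ I := by
  rw [saturation, Submodule.mem_iSup_of_directed _ (monotone_colon_pow_idealOfVars I).directed_le]
  exact exists_congr fun k => mem_colon_pow_idealOfVars

lemma le_saturation (I : Ideal (MvPolynomial (Fin n) K)) : I ≤ saturation I :=
  fun _ hf => mem_saturation.mpr ⟨0, fun _ _ => I.mul_mem_left _ hf⟩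

lemma saturation_mono (h : I ≤ J) : saturation I ≤ saturation J :=
  iSup_mono fun _ => Submodule.colon_mono h subset_rfl

lemma exists_saturation_eq_colon (I : Ideal (MvPolynomial (Fin n) K)) : ∃ k, saturation I =
    I.colon (idealOfVars (Fin n) K ^ k : Ideal (MvPolynomial (Fin n) K)) :=
  ⟨_, WellFoundedGT.iSup_eq_monotonicSequenceLimit ⟨_, monotone_colon_pow_idealOfVars I⟩⟩

lemma saturation_saturation (I : Ideal (MvPolynomial (Fin n) K)) :
    saturation (saturation I) = saturation I := by
  refine le_antisymm (fun f hf => ?_) (le_saturation _)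
  obtain ⟨k, hk⟩ := exists_saturation_eq_colon I
  obtain ⟨k', hk'⟩ := mem_saturation.mp hf
  have hmem : idealOfVars (Fin n) K ^ (k + k') ≤ I.colon {f} := by
    rw [pow_add, mul_comm, Ideal.mul_le]
    intro u hu w hw
    have hle : idealOfVars (Fin n) K ^ k' ≤ (saturation I).colon {f} :=
      pow_idealOfVars_le_iff.mpr fun v hv => Submodule.mem_colon_singleton.mpr (hk' v hv)
    have huf := Submodule.mem_colon_singleton.mp (hle hu)
    rw [hk] at huf
    rw [Submodule.mem_colon_singleton, smul_eq_mul, mul_right_comm]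
    exact Submodule.mem_colon.mp huf w hw
  exact mem_saturation.mpr ⟨k + k', fun u hu =>
    Submodule.mem_colon_singleton.mp (pow_idealOfVars_le_iff.mp hmem u hu)⟩

lemma saturation_eq_top (h : idealOfVars (Fin n) K ^ k ≤ I) : saturation I = ⊤ :=
  (Ideal.eq_top_iff_one _).mpr <| mem_saturation.mpr
    ⟨k, fun u hu => I.mul_mem_right _ (pow_idealOfVars_le_iff.mp h u hu)⟩

protected lemma Homog.saturation (h : Homog I) : Homog (saturation I) := by
  refine isHomogeneous_iff_homogeneousComponent_mem.mpr fun f hf d => ?_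
  obtain ⟨k, hk⟩ := mem_saturation.mp hf
  refine mem_saturation.mpr ⟨k, fun u hu => ?_⟩
  rw [← homogeneousComponent_mul_add hu]
  exact homogeneousComponent_mem_of_mem h (hk u hu) _

lemma mem_of_mem_saturation_of_socle
    (hsocle : ∀ g e, d ≤ e → g.IsHomogeneous e → (∀ a, X a * g ∈ I) → g ∈ I)
    (hde : d ≤ e) (hf : f.IsHomogeneous e) (h : f ∈ saturation I) : f ∈ I := by
  obtain ⟨k, hk⟩ := mem_saturation.mp h
  clear h
  induction k generalizing f e with
  | zero => simpa using hk 1 (isHomogeneous_one _ _)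
  | succ k ih =>
    refine hsocle f e hde hf fun a =>
      ih (hde.trans (Nat.le_add_left e 1)) ((isHomogeneous_X K a).mul hf) fun u hu => ?_
    rw [← mul_assoc]
    exact hk _ (hu.mul (isHomogeneous_X K a))

end Saturation

section Regularity

variable {K : Type*} [Field K] {n : ℕ} {I : Ideal (MvPolynomial (Fin n) K)} {i j d e r : ℕ}
  {f : MvPolynomial (Fin n) K}

instance finite_twistedForms (i j : ℕ) : Module.Finite K (twistedForms (Fin n) K i j) := by
  rcases lt_or_ge j i with h | h
  · rw [twistedForms_eq_bot h]
    infer_instance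
  · obtain ⟨s, rfl⟩ := Nat.exists_eq_add_of_le h
    have heq : twistedForms (Fin n) K i (i + s) = homogeneousSubmodule (Fin n) K s :=
      Submodule.ext fun _ => mem_twistedForms_add
    rw [heq]
    exact Module.Finite.iff_fg.mpr (homogeneousSubmodule_fg (Fin n) K s)

instance finite_koszulChains (I : Ideal (MvPolynomial (Fin n) K)) (i j : ℕ) :
    Module.Finite K (koszulChains I i j) := by
  have : Module.Finite K (Submodule.pi Set.univ
      fun _ : Finset (Fin n) => twistedForms (Fin n) K i j) :=
    Module.Finite.iff_fg.mpr (Submodule.fg_pi fun _ => Module.Finite.iff_fg.mp inferInstance)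
  have hle : koszulChains I i j ≤
      Submodule.pi Set.univ fun _ : Finset (Fin n) => twistedForms (Fin n) K i j :=
    fun _ hc => Submodule.mem_pi.mpr fun S _ => (mem_koszulChains.mp hc S).2.1
  exact Submodule.finiteDimensional_of_le hle

lemma gradedBetti_eq_zero_iff :
    gradedBetti I i j = 0 ↔ koszulCycles I i j ≤ koszulBoundaries I i j := by
  have : Module.Finite K (koszulCycles I i j) := Submodule.finiteDimensional_of_le inf_le_left
  rw [gradedBetti, Module.finrank_zero_iff, Submodule.Quotient.subsingleton_iff,
    Submodule.submoduleOf_eq_top]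

lemma mem_of_forall_X_mul_mem_of_gradedBetti_eq_zero {m : ℕ}
    {I : Ideal (MvPolynomial (Fin (m + 1)) K)} (hI : gradedBetti I m (m + 1 + e) = 0)
    {f : MvPolynomial (Fin (m + 1)) K} (hf : f.IsHomogeneous e) (h : ∀ a, X a * f ∈ I) :
    f ∈ I := by
  let c : Finset (Fin (m + 1)) → MvPolynomial (Fin (m + 1)) K := Pi.single Finset.univ f
  have hcard : (Finset.univ : Finset (Fin (m + 1))).card = m + 1 := Finset.card_fin _
  have hc : c ∈ koszulChains ⊤ (m + 1) (m + 1 + e) := by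
    have := single_mem_koszulChains (S := Finset.univ) (I := ⊤) Submodule.mem_top
      (mem_twistedForms_add.mpr hf)
    rwa [hcard] at this
  have hXc : ∀ a S, X a * c S ∈ I := by
    intro a S
    obtain rfl | hS := eq_or_ne S Finset.univ
    · simpa [c] using h a
    · simp [c, Pi.single_eq_of_ne hS]
  have hD : koszulD K (m + 1) c ∈ koszulChains I m (m + 1 + e) :=
    mem_koszulChains_of_top (koszulD_mem_koszulChains hc) fun T => by
      rw [koszulD_apply]
      exact I.sum_mem fun a _ => by rw [mul_assoc]; exact I.mul_mem_left _ (hXc a _)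
  obtain ⟨w, hw, hDw⟩ := gradedBetti_eq_zero_iff.mp hI ⟨hD, koszulD_koszulD c⟩
  have hwc := congrFun hDw (Finset.univ.erase 0)
  rw [koszulD_univ_erase, koszulD_univ_erase] at hwc
  have hsign : koszulSign K (Finset.univ : Finset (Fin (m + 1))) 0 * X 0 ≠ 0 :=
    mul_ne_zero (left_ne_zero_of_mul_eq_one (koszulSign_mul_self _ _)) (X_ne_zero _)
  have hwf : w Finset.univ = f := by simpa [c] using mul_left_cancel₀ hsign hwc
  exact hwf ▸ (mem_koszulChains.mp hw _).1

/-- `reg(I) ≤ r`, expressed by the vanishing of the Betti numbers `β_{ij}(I)` with `j - i > r`.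
Unlike an inequality `regularity I ≤ r`, it makes no use of the supremum in `regularity`, whose
value on an unbounded set is `0`. -/
def IsMumfordRegular (I : Ideal (MvPolynomial (Fin n) K)) (r : ℕ) : Prop :=
  ∀ i j, r + i < j → gradedBetti I i j = 0

lemma isMumfordRegular_iff :
    IsMumfordRegular I r ↔ ∀ i j, r + i < j → koszulCycles I i j ≤ koszulBoundaries I i j :=
  forall₃_congr fun _ _ _ => gradedBetti_eq_zero_iff

lemma isMumfordRegular_top : IsMumfordRegular (⊤ : Ideal (MvPolynomial (Fin n) K)) 0 :=
  isMumfordRegular_iff.mpr fun _ _ h => koszulCycles_top_le_koszulBoundaries (by omega)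

namespace IsMumfordRegular

lemma mono (h : IsMumfordRegular I r) {s : ℕ} (hrs : r ≤ s) : IsMumfordRegular I s :=
  fun i j hij => h i j (by omega)

lemma le_of_gradedBetti_ne_zero (h : IsMumfordRegular I r) {s : ℕ}
    (hne : gradedBetti I i (s + i) ≠ 0) : s ≤ r := by
  by_contra! hlt
  exact hne (h i _ (by omega))

lemma regularity_le (h : IsMumfordRegular I r) : regularity I ≤ r :=
  csSup_le' fun _ ⟨_, _, hne, hs⟩ => h.le_of_gradedBetti_ne_zero (hs ▸ hne)

protected lemma regularity (h : IsMumfordRegular I r) : IsMumfordRegular I (regularity I) := by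
  intro i j hij
  have hbdd : BddAbove {r | ∃ i j : ℕ, gradedBetti I i j ≠ 0 ∧ r + i = j} :=
    ⟨r, fun _ ⟨_, _, hne, hs⟩ => h.le_of_gradedBetti_ne_zero (hs ▸ hne)⟩
  by_contra hne
  have : j - i ≤ regularity I := le_csSup hbdd ⟨i, j, hne, by omega⟩
  omega

lemma le_of_le_pow (hr : IsMumfordRegular I r) (h : I ≤ idealOfVars (Fin n) K ^ d)
    (hd : component I d ≠ ⊥) : d ≤ r := by
  obtain ⟨f, hf, hf0⟩ := Submodule.exists_mem_ne_zero_of_ne_bot hd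
  obtain ⟨hfI, hfd⟩ := mem_component.mp hf
  by_contra! hlt
  have hchain : Pi.single ∅ f ∈ koszulChains I 0 d :=
    single_mem_koszulChains (S := ∅) hfI <| by
      rwa [Finset.card_empty, ← Nat.zero_add d, mem_twistedForms_add]
  obtain ⟨w, hw, hDw⟩ := isMumfordRegular_iff.mp hr 0 d hlt
    ⟨hchain, koszulD_eq_zero_of_mem_koszulChains_zero hchain⟩
  have hw0 : w = 0 := funext fun S => by
    obtain ⟨hwI, hdeg, -⟩ := mem_koszulChains.mp hw S
    obtain ⟨s, rfl⟩ := Nat.exists_eq_add_of_lt hlt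
    rw [add_comm (r + s), mem_twistedForms_add] at hdeg
    exact eq_zero_of_isHomogeneous_of_mem_pow hdeg (h hwI) (by omega)
  rw [hw0, map_zero] at hDw
  exact hf0 (by simpa using (congrFun hDw ∅).symm)

lemma mem_of_forall_X_mul_mem [NeZero n] (hr : IsMumfordRegular I r) (hre : r ≤ e)
    (hf : f.IsHomogeneous e) (h : ∀ a, X a * f ∈ I) : f ∈ I := by
  obtain ⟨m, rfl⟩ := Nat.exists_eq_succ_of_ne_zero (NeZero.ne n)
  exact mem_of_forall_X_mul_mem_of_gradedBetti_eq_zero (hr m (m + 1 + e) (by omega)) hf h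

lemma component_saturation [NeZero n] (hr : IsMumfordRegular I r) (hre : r ≤ e) :
    component (saturation I) e = component I e := by
  refine le_antisymm (fun f hf => ?_) (component_mono (le_saturation I) e)
  obtain ⟨hfsat, hfe⟩ := mem_component.mp hf
  exact mem_component.mpr ⟨mem_of_mem_saturation_of_socle
    (fun g e' he' hg hX => hr.mem_of_forall_X_mul_mem he' hg hX) hre hfe hfsat, hfe⟩

end IsMumfordRegular

lemma isMumfordRegular_regularity_of_ne_zero (h : regularity I ≠ 0) :
    IsMumfordRegular I (regularity I) := by
  have hbdd : BddAbove {r | ∃ i j : ℕ, gradedBetti I i j ≠ 0 ∧ r + i = j} := by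
    by_contra hunbdd
    exact h (Nat.sSup_of_not_bddAbove hunbdd)
  obtain ⟨r, hr⟩ := hbdd
  refine IsMumfordRegular.regularity (r := r) fun i j hij => ?_
  by_contra hne
  have : j - i ≤ r := hr ⟨i, j, hne, by omega⟩
  omega

end Regularity

section RegularLinearForm

variable {K : Type*} [Field K] {n : ℕ} {Q : Ideal (MvPolynomial (Fin n) K)}
  {l : MvPolynomial (Fin n) K} {i j d r s : ℕ}

/-- `l` is a linear form and a non-zero-divisor modulo `Q`. -/
structure IsRegularLinearForm (Q : Ideal (MvPolynomial (Fin n) K))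
    (l : MvPolynomial (Fin n) K) : Prop where
  isHomogeneous : l.IsHomogeneous 1
  mem_of_mul_mem : ∀ f, l * f ∈ Q → f ∈ Q

lemma isRegularLinearForm_of_saturation_eq (hsat : saturation Q = Q) (hl : l.IsHomogeneous 1)
    (hpow : idealOfVars (Fin n) K ^ r ≤ Q ⊔ Ideal.span {l}) : IsRegularLinearForm Q l := by
  refine ⟨hl, fun f hf => hsat.le (mem_saturation.mpr ⟨r, fun u hu => ?_⟩)⟩
  obtain ⟨q, hq, y, hy, rfl⟩ := Submodule.mem_sup.mp (pow_idealOfVars_le_iff.mp hpow u hu)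
  obtain ⟨g, rfl⟩ := Ideal.mem_span_singleton.mp hy
  rw [add_mul, mul_right_comm, mul_comm (l * f)]
  exact Q.add_mem (Q.mul_mem_right _ hq) (Q.mul_mem_left _ hf)

lemma exists_koszulChains_add_smul (hQ : Homog Q) (hl : l.IsHomogeneous 1)
    {c : Finset (Fin n) → MvPolynomial (Fin n) K}
    (hc : c ∈ koszulChains (Q ⊔ Ideal.span {l}) i (j + 1)) :
    ∃ q ∈ koszulChains Q i (j + 1), ∃ u ∈ koszulChains ⊤ i j, q + l • u = c := by
  have hS : ∀ S, ∃ q g, (q ∈ Q ∧ q ∈ twistedForms (Fin n) K i (j + 1) ∧ (S.card ≠ i → q = 0)) ∧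
      (g ∈ twistedForms (Fin n) K i j ∧ (S.card ≠ i → g = 0)) ∧ q + l * g = c S := by
    intro S
    obtain ⟨hmem, hdeg, hzero⟩ := mem_koszulChains.mp hc S
    by_cases hS : S.card = i
    · obtain ⟨q, hqQ, hq, g, hg, hqg⟩ := exists_twistedForms_of_mem_sup_span hQ hl hdeg hmem
      exact ⟨q, g, ⟨hqQ, hq, absurd hS⟩, ⟨hg, absurd hS⟩, hqg⟩
    · exact ⟨0, 0, ⟨Q.zero_mem, Submodule.zero_mem _, fun _ => rfl⟩,
        ⟨Submodule.zero_mem _, fun _ => rfl⟩, by rw [hzero hS, mul_zero, add_zero]⟩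
  choose q u hq hu hqu using hS
  exact ⟨q, mem_koszulChains.mpr hq, u,
    mem_koszulChains.mpr fun S => ⟨Submodule.mem_top, hu S⟩, funext hqu⟩

protected lemma IsRegularLinearForm.koszulD_mem_koszulChains (h : IsRegularLinearForm Q l)
    {q u : Finset (Fin n) → MvPolynomial (Fin n) K} (hq : q ∈ koszulChains Q (i + 1) (j + 1))
    (hu : u ∈ koszulChains ⊤ (i + 1) j) (hqu : ∀ S, koszulD K n (q + l • u) S ∈ Q) :
    koszulD K n u ∈ koszulChains Q i j := by
  refine mem_koszulChains_of_top (koszulD_mem_koszulChains hu) fun S =>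
    h.mem_of_mul_mem _ ?_
  have hDq := (mem_koszulChains.mp (koszulD_mem_koszulChains hq) S).1
  rw [map_add, koszulD_smul] at hqu
  exact (Q.add_mem_iff_right hDq).mp (hqu S)

theorem IsRegularLinearForm.isMumfordRegular (h : IsRegularLinearForm Q l) (hQ : Homog Q)
    (hpow : idealOfVars (Fin n) K ^ r ≤ Q ⊔ Ideal.span {l}) : IsMumfordRegular Q r := by
  -- A cycle of `Q` is the boundary in `R` of some `v = q + l u` with `q` in `Q`. Then `D u` lies in
  -- `Q` because `l` is regular, and `l D u` is a boundary in `Q` because `l` is null-homotopic.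
  rw [isMumfordRegular_iff]
  intro i j hij z hz
  obtain ⟨hzQ, hDz⟩ := Submodule.mem_inf.mp hz
  obtain ⟨s, rfl⟩ := Nat.exists_eq_add_of_lt hij
  obtain ⟨v, hv, rfl⟩ := koszulCycles_top_le_koszulBoundaries (Nat.succ_ne_zero (r + i + s))
    (Submodule.mem_inf.mpr ⟨koszulChains_mono le_top hzQ, hDz⟩)
  have hvQ : v ∈ koszulChains (Q ⊔ Ideal.span {l}) (i + 1) (r + i + s + 1) :=
    mem_koszulChains_of_top hv fun S => hpow <| by
      have hdeg := (mem_koszulChains.mp hv S).2.1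
      rw [show (r + i + s).succ = i + 1 + (r + s) by omega, mem_twistedForms_add] at hdeg
      exact mem_pow_idealOfVars_of_isHomogeneous hdeg (Nat.le_add_right r s)
  obtain ⟨q, hq, u, hu, rfl⟩ := exists_koszulChains_add_smul hQ h.isHomogeneous hvQ
  have hDu := h.koszulD_mem_koszulChains hq hu fun S => (mem_koszulChains.mp hzQ S).1
  obtain ⟨H, hDH, hH⟩ := exists_koszul_homotopy h.isHomogeneous
  have hDHD := hDH (koszulD K n u)
  rw [koszulD_koszulD, map_zero, add_zero] at hDHD
  refine ⟨q + H (koszulD K n u), Submodule.add_mem _ hq (hH _ _ _ _ hDu), ?_⟩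
  rw [map_add, map_add, hDHD, koszulD_smul]

theorem IsRegularLinearForm.gradedBetti_sup_span_eq_zero (h : IsRegularLinearForm Q l)
    (hQ : Homog Q) (hj : j ≠ 0) (hzero : gradedBetti Q i j = 0)
    (hsucc : gradedBetti Q (i + 1) (j + 1) = 0) :
    gradedBetti (Q ⊔ Ideal.span {l}) (i + 1) (j + 1) = 0 := by
  -- Part of the long exact sequence of `0 → Q(-1) → Q ⊕ R(-1) → Q + (l) → 0`.
  rw [gradedBetti_eq_zero_iff] at hzero hsucc ⊢
  intro c hc
  obtain ⟨hcQ, hDc⟩ := Submodule.mem_inf.mp hc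
  obtain ⟨q, hq, u, hu, rfl⟩ := exists_koszulChains_add_smul hQ h.isHomogeneous hcQ
  rw [LinearMap.mem_ker] at hDc
  have hDu := h.koszulD_mem_koszulChains hq hu fun S => by rw [hDc]; exact Q.zero_mem
  obtain ⟨q', hq', hDq'⟩ := hzero ⟨hDu, koszulD_koszulD u⟩
  have hcycle : u - q' ∈ koszulCycles ⊤ (i + 1) j :=
    ⟨Submodule.sub_mem _ hu (koszulChains_mono le_top hq'),
      LinearMap.mem_ker.mpr (by rw [map_sub, hDq', sub_self])⟩
  obtain ⟨v, hv, hDv⟩ := koszulCycles_top_le_koszulBoundaries hj hcycle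
  have hcycle' : q + l • q' ∈ koszulCycles Q (i + 1) (j + 1) :=
    ⟨Submodule.add_mem _ hq (smul_mem_koszulChains h.isHomogeneous hq'),
      LinearMap.mem_ker.mpr (by rw [map_add, koszulD_smul, hDq', ← koszulD_smul, ← map_add, hDc])⟩
  obtain ⟨p, hp, hDp⟩ := hsucc hcycle'
  have hlv : l • v ∈ koszulChains (Q ⊔ Ideal.span {l}) (i + 1 + 1) (j + 1) :=
    mem_koszulChains_of_top (smul_mem_koszulChains h.isHomogeneous hv) fun S =>
      Ideal.mul_mem_right _ _ (Ideal.mem_sup_right (Ideal.mem_span_singleton_self l))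
  refine ⟨p + l • v, Submodule.add_mem _ (koszulChains_mono le_sup_left hp) hlv, ?_⟩
  rw [map_add, koszulD_smul, hDp, hDv, smul_sub]
  abel

theorem IsRegularLinearForm.pow_le_sup_span (h : IsRegularLinearForm Q l) (hQ : Homog Q)
    (hn : 2 ≤ n) (hr : IsMumfordRegular Q r)
    (hpow : idealOfVars (Fin n) K ^ s ≤ Q ⊔ Ideal.span {l}) :
    idealOfVars (Fin n) K ^ r ≤ Q ⊔ Ideal.span {l} := by
  obtain ⟨m, rfl⟩ := Nat.exists_eq_add_of_le' hn
  refine pow_idealOfVars_le_iff.mpr fun f hf => ?_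
  refine mem_of_mem_saturation_of_socle (fun g e hre hg hX => ?_) le_rfl hf
    (saturation_eq_top hpow ▸ Submodule.mem_top)
  refine mem_of_forall_X_mul_mem_of_gradedBetti_eq_zero ?_ hg hX
  rw [show m + 1 + 1 + e = m + 1 + e + 1 by omega]
  exact h.gradedBetti_sup_span_eq_zero hQ (by omega) (hr _ _ (by omega)) (hr _ _ (by omega))

lemma exists_ne_zero_eval_eq_zero (hn : 2 ≤ n) (hl : l.IsHomogeneous 1) :
    ∃ p : Fin n → K, p ≠ 0 ∧ eval p l = 0 := by
  rw [← mem_homogeneousSubmodule, homogeneousSubmodule_one_eq_span_X,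
    Submodule.mem_span_range_iff_exists_fun] at hl
  obtain ⟨c, rfl⟩ := hl
  have hker : LinearMap.ker (Fintype.linearCombination K c) ≠ ⊥ :=
    LinearMap.ker_ne_bot_of_finrank_lt (by simpa using Nat.lt_of_succ_le hn)
  obtain ⟨p, hp, hp0⟩ := Submodule.exists_mem_ne_zero_of_ne_bot hker
  refine ⟨p, hp0, ?_⟩
  simpa [Fintype.linearCombination_apply, smul_eval, mul_comm] using hp

lemma Homog.exists_component_succ_add_mul_eq (hQ : Homog Q) (hl : l.IsHomogeneous 1)
    {f : MvPolynomial (Fin n) K} (hf : f.IsHomogeneous (d + 1)) (h : f ∈ Q ⊔ Ideal.span {l}) :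
    ∃ q ∈ component Q (d + 1), ∃ g : MvPolynomial (Fin n) K, g.IsHomogeneous d ∧ q + l * g = f := by
  obtain ⟨q, hqQ, hq, g, hg, rfl⟩ := exists_twistedForms_of_mem_sup_span (i := 0) hQ hl
    (by rwa [← Nat.zero_add (d + 1), mem_twistedForms_add]) h
  rw [← Nat.zero_add d, mem_twistedForms_add] at hg
  rw [← Nat.zero_add (d + 1), mem_twistedForms_add] at hq
  exact ⟨q, mem_component.mpr ⟨hqQ, hq⟩, g, hg, rfl⟩

lemma Homog.exists_component_add_mul_eq (hQ : Homog Q) (hl : l.IsHomogeneous 1)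
    {f : MvPolynomial (Fin n) K} (hf : f.IsHomogeneous d) (h : f ∈ Q ⊔ Ideal.span {l}) :
    ∃ q ∈ component Q d, ∃ g, q + l * g = f := by
  obtain ⟨q, hqQ, hq, g, -, rfl⟩ := exists_twistedForms_of_mem_sup_span (i := 1) (j := d) hQ hl
    (by rwa [add_comm, mem_twistedForms_add]) h
  rw [add_comm, mem_twistedForms_add] at hq
  exact ⟨q, mem_component.mpr ⟨hqQ, hq⟩, g, rfl⟩

lemma component_ne_bot_of_pow_le_sup_span (hn : 2 ≤ n) (hQ : Homog Q) (hl : l.IsHomogeneous 1)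
    (hpow : idealOfVars (Fin n) K ^ d ≤ Q ⊔ Ideal.span {l}) : component Q d ≠ ⊥ := by
  intro hbot
  obtain ⟨p, hp, hpl⟩ := exists_ne_zero_eval_eq_zero hn hl
  obtain ⟨b, hb⟩ := Function.ne_iff.mp hp
  have hX : (X b ^ d : MvPolynomial (Fin n) K).IsHomogeneous d := isHomogeneous_X_pow b d
  obtain ⟨q, hq, g, hqg⟩ := hQ.exists_component_add_mul_eq hl hX
    (pow_idealOfVars_le_iff.mp hpow _ hX)
  obtain rfl : q = 0 := by rwa [hbot, Submodule.mem_bot] at hq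
  have heval := congrArg (eval p) hqg
  rw [zero_add, map_mul, hpl, zero_mul, map_pow, eval_X] at heval
  exact pow_ne_zero d hb heval.symm

end RegularLinearForm

section Truncation

variable {K : Type*} [Field K] {n : ℕ} {I J : Ideal (MvPolynomial (Fin n) K)} {d e : ℕ}

lemma Homog.inf_pow_le (hI : Homog I) (h : ∀ e, d ≤ e → component I e ≤ component J e) :
    I ⊓ idealOfVars (Fin n) K ^ d ≤ J := by
  have hinf : Homog (I ⊓ idealOfVars (Fin n) K ^ d) :=
    Ideal.IsHomogeneous.inf hI (isHomogeneous_pow_idealOfVars d)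
  refine hinf.le_of_component_le fun e => ?_
  rcases lt_or_ge e d with he | he
  · rw [component_eq_bot_of_le_pow inf_le_right he]
    exact bot_le
  · exact (component_mono inf_le_left e).trans (h e he)

lemma Homog.saturation_le_saturation (hI : Homog I)
    (h : ∀ e, d ≤ e → component I e ≤ component J e) : saturation I ≤ saturation J := by
  have hle : I ≤ saturation J := fun f hf => mem_saturation.mpr ⟨d, fun u hu =>
    hI.inf_pow_le h ⟨I.mul_mem_left u hf,
      Ideal.mul_mem_right _ _ (mem_pow_idealOfVars_of_isHomogeneous hu le_rfl)⟩⟩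
  exact (saturation_mono hle).trans (saturation_saturation J).le

namespace IsMumfordRegular

lemma of_component_le (hr : IsMumfordRegular I d) (hJ : J ≤ I)
    (h : ∀ e, d ≤ e → component I e ≤ component J e) : IsMumfordRegular J d := by
  rw [isMumfordRegular_iff] at hr ⊢
  intro i j hij z hz
  obtain ⟨w, hw, hDw⟩ := hr i j hij ⟨koszulChains_mono hJ hz.1, hz.2⟩
  refine ⟨w, mem_koszulChains.mpr fun S => ?_, hDw⟩
  obtain ⟨hwI, hdeg, hzero⟩ := mem_koszulChains.mp hw S
  obtain ⟨s, rfl⟩ := Nat.exists_eq_add_of_lt hij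
  rw [show d + i + s + 1 = i + 1 + (d + s) by omega] at hdeg ⊢
  exact ⟨(mem_component.mp (h _ (Nat.le_add_right d s)
    (mem_component.mpr ⟨hwI, mem_twistedForms_add.mp hdeg⟩))).1, hdeg, hzero⟩

lemma component_componentIdeal (hr : IsMumfordRegular I d) (hde : d ≤ e) :
    component (componentIdeal I d) e = component I e := by
  refine le_antisymm (component_mono (componentIdeal_le I d) e) fun f hf => ?_
  obtain ⟨hfI, hfe⟩ := mem_component.mp hf
  refine mem_component.mpr ⟨?_, hfe⟩
  clear hf
  induction e, hde using Nat.le_induction generalizing f with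
  | base => exact Ideal.subset_span (mem_component.mpr ⟨hfI, hfe⟩)
  | succ e hde ih =>
    have hchain : Pi.single ∅ f ∈ koszulChains I 0 (e + 1) :=
      single_mem_koszulChains (S := ∅) hfI <| by
        rwa [Finset.card_empty, ← Nat.zero_add (e + 1), mem_twistedForms_add]
    obtain ⟨w, hw, hDw⟩ := isMumfordRegular_iff.mp hr 0 (e + 1) (by omega)
      ⟨hchain, koszulD_eq_zero_of_mem_koszulChains_zero hchain⟩
    have hfw := congrFun hDw ∅
    rw [koszulD_empty, Pi.single_eq_same] at hfw
    rw [← hfw]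
    refine Ideal.sum_mem _ fun a _ => Ideal.mul_mem_left _ _ ?_
    obtain ⟨hwI, hdeg, -⟩ := mem_koszulChains.mp hw {a}
    rw [add_comm e, mem_twistedForms_add] at hdeg
    exact ih _ hwI hdeg

lemma saturation_componentIdeal (hr : IsMumfordRegular I d) (hI : Homog I) :
    saturation (componentIdeal I d) = saturation I :=
  le_antisymm (saturation_mono (componentIdeal_le I d))
    (hI.saturation_le_saturation fun _ hde => (hr.component_componentIdeal hde).ge)

protected lemma componentIdeal (hr : IsMumfordRegular I d) :
    IsMumfordRegular (componentIdeal I d) d :=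
  hr.of_component_le (componentIdeal_le I d) fun _ hde => (hr.component_componentIdeal hde).ge

end IsMumfordRegular

lemma hasLinearResolution_componentIdeal_iff (hd : component I d ≠ ⊥) :
    HasLinearResolution (componentIdeal I d) ↔ IsMumfordRegular (componentIdeal I d) d := by
  have hJd : component (componentIdeal I d) d ≠ ⊥ := by rwa [component_componentIdeal_self]
  have hne : componentIdeal I d ≠ ⊥ := fun h => hJd (by rw [h, component_bot])
  rw [HasLinearResolution, or_iff_right hne,
    initialDegree_eq (componentIdeal_le_pow I d) hJd]
  refine ⟨fun h => ?_, fun h => le_antisymm h.regularity_le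
    (h.regularity.le_of_le_pow (componentIdeal_le_pow I d) hJd)⟩
  obtain rfl | hd0 := eq_or_ne d 0
  · rw [eq_top_of_component_zero_ne_bot hJd]
    exact isMumfordRegular_top
  · have := isMumfordRegular_regularity_of_ne_zero (h.trans_ne hd0)
    rwa [h] at this

end Truncation

section KrullDimension

lemma ringKrullDim_le_of_isIntegral (B A : Type*) [CommRing B] [CommRing A] [Algebra B A]
    [Algebra.IsIntegral B A] : ringKrullDim A ≤ ringKrullDim B :=
  Order.krullDim_le_of_strictMono (PrimeSpectrum.comap (algebraMap B A)) fun P P' hP =>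
    Ideal.IsIntegral.comap_lt_comap (I := P.asIdeal) (J := P'.asIdeal) hP

lemma ringKrullDim_adjoin_singleton_le_one (K : Type*) {A : Type*} [Field K] [CommRing A]
    [Algebra K A] (x : A) : ringKrullDim (Algebra.adjoin K {x}) ≤ 1 := by
  rw [← IsPrincipalIdealRing.ringKrullDim_eq_one (Polynomial K) (Polynomial.not_isField K),
    ringKrullDim_eq_of_ringEquiv
      (Subalgebra.equivOfEq _ _ (Algebra.adjoin_singleton_eq_range_aeval K x)).toRingEquiv]
  exact ringKrullDim_le_of_surjective (Polynomial.aeval (R := K) x).rangeRestrict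
    (Polynomial.aeval (R := K) x).rangeRestrict_surjective

lemma ringKrullDim_quotient_sup_span_add_one_le {A : Type*} [CommRing A] {Q : Ideal A} {l : A}
    (h : ∀ f, l * f ∈ Q → f ∈ Q) :
    ringKrullDim (A ⧸ Q ⊔ Ideal.span {l}) + 1 ≤ ringKrullDim (A ⧸ Q) := by
  have hl : Ideal.Quotient.mk Q l ∈ nonZeroDivisors (A ⧸ Q) := by
    rw [mem_nonZeroDivisors_iff_right]
    intro x hx
    obtain ⟨f, rfl⟩ := Ideal.Quotient.mk_surjective x
    rw [← map_mul, Ideal.Quotient.eq_zero_iff_mem, mul_comm] at hx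
    exact Ideal.Quotient.eq_zero_iff_mem.mpr (h f hx)
  have hdim := ringKrullDim_quotient_succ_le_of_nonZeroDivisor hl
  rwa [← Set.image_singleton, ← Ideal.map_span,
    ringKrullDim_eq_of_ringEquiv (DoubleQuot.quotQuotEquivQuotSup _ _)] at hdim

end KrullDimension

section FiniteColength

variable {K : Type*} [Field K] {n : ℕ} {I : Ideal (MvPolynomial (Fin n) K)} {k : ℕ}

lemma Homog.exists_pow_le_of_finite (hI : Homog I)
    [Module.Finite K (MvPolynomial (Fin n) K ⧸ I)] : ∃ k, idealOfVars (Fin n) K ^ k ≤ I := by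
  have : IsArtinianRing (MvPolynomial (Fin n) K ⧸ I) :=
    (Module.finite_iff_isArtinianRing K _).mp inferInstance
  let 𝔪 := (idealOfVars (Fin n) K).map (Ideal.Quotient.mk I)
  obtain ⟨k, hk⟩ := IsArtinian.monotone_stabilizes
    (⟨fun k => OrderDual.toDual (𝔪 ^ k), fun _ _ h => Ideal.pow_le_pow_right h⟩ :
      ℕ →o (Ideal (MvPolynomial (Fin n) K ⧸ I))ᵒᵈ)
  have hk : 𝔪 ^ k = 𝔪 ^ (k + 1) := OrderDual.toDual.injective (hk (k + 1) (Nat.le_succ k))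
  refine ⟨k, pow_idealOfVars_le_iff.mpr fun f hf => ?_⟩
  have hmem : Ideal.Quotient.mk I f ∈ 𝔪 ^ (k + 1) := by
    rw [← hk, ← Ideal.map_pow]
    exact Ideal.mem_map_of_mem _ (mem_pow_idealOfVars_of_isHomogeneous hf le_rfl)
  rw [← Ideal.map_pow, Ideal.mem_map_iff_of_surjective _ Ideal.Quotient.mk_surjective] at hmem
  obtain ⟨g, hg, hgf⟩ := hmem
  have hgk : homogeneousComponent k g = 0 := eq_zero_of_isHomogeneous_of_mem_pow
    (homogeneousComponent_isHomogeneous k g)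
    (isHomogeneous_iff_homogeneousComponent_mem.mp (isHomogeneous_pow_idealOfVars (k + 1)) g hg k)
    (Nat.lt_succ_self k)
  have hsub := isHomogeneous_iff_homogeneousComponent_mem.mp hI _ (Ideal.Quotient.eq.mp hgf) k
  rwa [map_sub, homogeneousComponent_eq_self hf, hgk, zero_sub, neg_mem_iff] at hsub

lemma fg_map_restrictTotalDegree (I : Ideal (MvPolynomial (Fin n) K)) (k : ℕ) :
    ((restrictTotalDegree (Fin n) K k).map (Ideal.Quotient.mkₐ K I).toLinearMap).FG :=
  (Module.Finite.iff_fg.mp inferInstance).map _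

lemma mk_mem_map_restrictTotalDegree (I : Ideal (MvPolynomial (Fin n) K)) {d : ℕ}
    {f : MvPolynomial (Fin n) K} (hf : f.IsHomogeneous d) (hd : d ≤ k) :
    Ideal.Quotient.mk I f ∈
      (restrictTotalDegree (Fin n) K k).map (Ideal.Quotient.mkₐ K I).toLinearMap :=
  ⟨f, (mem_restrictTotalDegree _ _ _).mpr (hf.totalDegree_le.trans hd), rfl⟩

lemma finite_of_pow_le (h : idealOfVars (Fin n) K ^ k ≤ I) :
    Module.Finite K (MvPolynomial (Fin n) K ⧸ I) := by
  have htop : (restrictTotalDegree (Fin n) K k).map (Ideal.Quotient.mkₐ K I).toLinearMap = ⊤ := by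
    refine eq_top_iff.mpr fun x _ => ?_
    obtain ⟨f, rfl⟩ := Ideal.Quotient.mk_surjective x
    rw [← sum_homogeneousComponent f, map_sum]
    refine Submodule.sum_mem _ fun d _ => ?_
    have hd := homogeneousComponent_isHomogeneous d f
    rcases le_total d k with hdk | hkd
    · exact mk_mem_map_restrictTotalDegree I hd hdk
    · rw [Ideal.Quotient.eq_zero_iff_mem.mpr (h (mem_pow_idealOfVars_of_isHomogeneous hd hkd))]
      exact Submodule.zero_mem _
  exact ⟨htop ▸ fg_map_restrictTotalDegree I k⟩

end FiniteColength

section GenericLinearForm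

variable {K : Type*} [Field K] {n : ℕ} {Q : Ideal (MvPolynomial (Fin n) K)}
  {l : MvPolynomial (Fin n) K} {r : ℕ}

lemma Homog.pow_le_sup_span_of_component_le (hQ : Homog Q) {J : Ideal (MvPolynomial (Fin n) K)}
    (hl : l.IsHomogeneous 1) (hpow : idealOfVars (Fin n) K ^ r ≤ Q ⊔ Ideal.span {l})
    (hJ : component Q r ≤ component J r) : idealOfVars (Fin n) K ^ r ≤ J ⊔ Ideal.span {l} := by
  refine pow_idealOfVars_le_iff.mpr fun f hf => ?_
  obtain ⟨q, hq, g, rfl⟩ := hQ.exists_component_add_mul_eq hl hf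
    (pow_idealOfVars_le_iff.mp hpow f hf)
  exact add_mem (Ideal.mem_sup_left (mem_component.mp (hJ hq)).1)
    (Ideal.mem_sup_right (Ideal.mul_mem_right _ _ (Ideal.mem_span_singleton_self l)))

lemma Homog.finite_adjoin_of_pow_le_sup_span (hQ : Homog Q) (hl : l.IsHomogeneous 1)
    (hpow : idealOfVars (Fin n) K ^ r ≤ Q ⊔ Ideal.span {l}) :
    Module.Finite (Algebra.adjoin K {Ideal.Quotient.mk Q l}) (MvPolynomial (Fin n) K ⧸ Q) := by
  set B := Algebra.adjoin K {Ideal.Quotient.mk Q l}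
  let V := (restrictTotalDegree (Fin n) K r).map (Ideal.Quotient.mkₐ K Q).toLinearMap
  have hhom : ∀ e (f : MvPolynomial (Fin n) K), f.IsHomogeneous e →
      Ideal.Quotient.mk Q f ∈ Submodule.span B (V : Set (MvPolynomial (Fin n) K ⧸ Q)) := by
    intro e
    induction e with
    | zero =>
      exact fun f hf => Submodule.subset_span (mk_mem_map_restrictTotalDegree Q hf (Nat.zero_le r))
    | succ e ih =>
      intro f hf
      rcases le_total (e + 1) r with he | he
      · exact Submodule.subset_span (mk_mem_map_restrictTotalDegree Q hf he)
      · obtain ⟨q, hq, g, hg, rfl⟩ := hQ.exists_component_succ_add_mul_eq hl hf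
          (hpow (mem_pow_idealOfVars_of_isHomogeneous hf he))
        rw [map_add, Ideal.Quotient.eq_zero_iff_mem.mpr (mem_component.mp hq).1, zero_add, map_mul]
        exact Submodule.smul_mem _
          (⟨Ideal.Quotient.mk Q l, Algebra.self_mem_adjoin_singleton K _⟩ : B) (ih g hg)
  have hspan : Submodule.span B (V : Set (MvPolynomial (Fin n) K ⧸ Q)) = ⊤ := by
    refine eq_top_iff.mpr fun x _ => ?_
    obtain ⟨f, rfl⟩ := Ideal.Quotient.mk_surjective x
    rw [← sum_homogeneousComponent f, map_sum]
    exact Submodule.sum_mem _ fun e _ => hhom e _ (homogeneousComponent_isHomogeneous e f)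
  obtain ⟨s, hs⟩ : V.FG := fg_map_restrictTotalDegree Q r
  exact ⟨⟨s, by rw [← hspan, ← hs, Submodule.span_span_of_tower]⟩⟩

lemma IsRegularLinearForm.ringKrullDim_eq_one (h : IsRegularLinearForm Q l) (hQ : Homog Q)
    (hpow : idealOfVars (Fin n) K ^ r ≤ Q ⊔ Ideal.span {l}) (hne : Q ≠ ⊤) :
    ringKrullDim (MvPolynomial (Fin n) K ⧸ Q) = 1 := by
  have := hQ.finite_adjoin_of_pow_le_sup_span h.isHomogeneous hpow
  refine le_antisymm ((ringKrullDim_le_of_isIntegral (Algebra.adjoin K {Ideal.Quotient.mk Q l})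
    _).trans (ringKrullDim_adjoin_singleton_le_one K _)) ?_
  have hsup : Q ⊔ Ideal.span {l} ≤ idealOfVars (Fin n) K ^ 1 :=
    sup_le (hQ.le_idealOfVars hne) ((Ideal.span_singleton_le_iff_mem _).mpr
      (mem_pow_idealOfVars_of_isHomogeneous h.isHomogeneous le_rfl))
  have hsup_ne : Q ⊔ Ideal.span {l} ≠ ⊤ := fun htop => one_ne_zero
    (eq_zero_of_isHomogeneous_of_mem_pow (isHomogeneous_one (Fin n) K)
      (hsup (htop ▸ Submodule.mem_top)) zero_lt_one)
  have := Ideal.Quotient.nontrivial_iff.mpr hsup_ne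
  exact (le_add_of_nonneg_left ringKrullDim_nonneg_of_nontrivial).trans
    (ringKrullDim_quotient_sup_span_add_one_le h.mem_of_mul_mem)

lemma IsRegularLinearForm.exists_pow_le_sup_span (h : IsRegularLinearForm Q l) (hQ : Homog Q)
    (hdim : ringKrullDim (MvPolynomial (Fin n) K ⧸ Q) ≤ 1) :
    ∃ s, idealOfVars (Fin n) K ^ s ≤ Q ⊔ Ideal.span {l} := by
  have hle := (ringKrullDim_quotient_sup_span_add_one_le h.mem_of_mul_mem).trans hdim
  rw [← zero_add 1] at hle
  have : Module.Finite K (MvPolynomial (Fin n) K ⧸ Q ⊔ Ideal.span {l}) :=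
    (Module.finite_iff_krullDimLE_zero K _).mpr
      (Ring.krullDimLE_iff.mpr (ENat.WithBot.add_le_add_one_right_iff.mp hle))
  exact Homog.exists_pow_le_of_finite
    (Ideal.IsHomogeneous.sup hQ (homog_span_singleton h.isHomogeneous))

lemma exists_isHomogeneous_one_forall_notMem [Infinite K] {s : Set (Ideal (MvPolynomial (Fin n) K))}
    (hs : s.Finite) (h : ∀ P ∈ s, ∃ u : MvPolynomial (Fin n) K, u.IsHomogeneous 1 ∧ u ∉ P) :
    ∃ l : MvPolynomial (Fin n) K, l.IsHomogeneous 1 ∧ ∀ P ∈ s, l ∉ P := by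
  classical
  let V := homogeneousSubmodule (Fin n) K 1
  have hV : ⊤ ∉ hs.toFinset.image fun P => (P.restrictScalars K).comap V.subtype := by
    rw [Finset.mem_image]
    rintro ⟨P, hP, htop⟩
    obtain ⟨u, hu, huP⟩ := h P (hs.mem_toFinset.mp hP)
    exact huP (htop.ge (Submodule.mem_top (x := (⟨u, hu⟩ : V))))
  obtain ⟨⟨l, hl⟩, hlP⟩ := (Set.ne_univ_iff_exists_notMem _).mp
    (Subspace.biUnion_ne_univ_of_top_notMem hV)
  simp only [Set.mem_iUnion, not_exists] at hlP
  exact ⟨l, hl, fun P hP hlmem =>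
    hlP _ (Finset.mem_image_of_mem _ (hs.mem_toFinset.mpr hP)) hlmem⟩

lemma exists_isHomogeneous_one_notMem_of_mem_associatedPrimes (hsat : saturation Q = Q)
    {P : Ideal (MvPolynomial (Fin n) K)}
    (hP : P ∈ associatedPrimes (MvPolynomial (Fin n) K) (MvPolynomial (Fin n) K ⧸ Q)) :
    ∃ u : MvPolynomial (Fin n) K, u.IsHomogeneous 1 ∧ u ∉ P := by
  by_contra! hle
  obtain ⟨hprime, x, hx⟩ := isAssociatedPrime_iff.mp hP
  obtain ⟨f, rfl⟩ := Ideal.Quotient.mk_surjective x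
  have hmem : ∀ u, u ∈ P ↔ u * f ∈ Q := fun u => by
    rw [hx, Submodule.mem_colon_singleton, Submodule.mem_bot, ← Ideal.Quotient.eq_zero_iff_mem]
    rfl
  refine hprime.ne_top ((Ideal.eq_top_iff_one P).mpr ((hmem 1).mpr ?_))
  rw [one_mul, ← hsat]
  exact mem_saturation.mpr ⟨1, fun u hu => (hmem u).mp (hle u hu)⟩

lemma exists_isRegularLinearForm [Infinite K] [NeZero n] (hsat : saturation Q = Q) :
    ∃ l, l ≠ 0 ∧ IsRegularLinearForm Q l := by
  let Ass := associatedPrimes (MvPolynomial (Fin n) K) (MvPolynomial (Fin n) K ⧸ Q)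
  obtain ⟨l, hl, hlP⟩ := exists_isHomogeneous_one_forall_notMem
    (s := insert ⊥ Ass) ((associatedPrimes.finite _ _).insert ⊥) <| by
      rintro P (rfl | hP)
      · exact ⟨X 0, isHomogeneous_X K 0, X_ne_zero 0⟩
      · exact exists_isHomogeneous_one_notMem_of_mem_associatedPrimes hsat hP
  refine ⟨l, hlP ⊥ (Set.mem_insert _ _), hl, fun f hf => ?_⟩
  by_contra hfQ
  have hzero : l ∈ ⋃ P ∈ Ass, (P : Set (MvPolynomial (Fin n) K)) := by
    rw [biUnion_associatedPrimes_eq_zero_divisors]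
    exact ⟨Ideal.Quotient.mk Q f, mt Ideal.Quotient.eq_zero_iff_mem.mp hfQ,
      Ideal.Quotient.eq_zero_iff_mem.mpr hf⟩
  simp only [Set.mem_iUnion] at hzero
  obtain ⟨P, hP, hlmem⟩ := hzero
  exact hlP P (Set.mem_insert_of_mem _ hP) hlmem

end GenericLinearForm

section FamilyIdeal

variable {K : Type*} [Field K] {n : ℕ} {E Q : ℕ → Ideal (MvPolynomial (Fin n) K)}

/-- The ideal `⊕_d (E_d)_d` cut out of an increasing sequence of ideals `E_d` by taking from each
`E_d` its forms of degree `d`. -/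
def diagonalIdeal (E : ℕ → Ideal (MvPolynomial (Fin n) K)) (hE : Monotone E) :
    Ideal (MvPolynomial (Fin n) K) where
  carrier := {f | ∀ d, homogeneousComponent d f ∈ E d}
  add_mem' hf hg d := by
    rw [map_add]
    exact (E d).add_mem (hf d) (hg d)
  zero_mem' d := by
    rw [map_zero]
    exact (E d).zero_mem
  smul_mem' a f hf d := by
    rw [smul_eq_mul, ← sum_homogeneousComponent a, Finset.sum_mul, map_sum]
    refine (E d).sum_mem fun i _ => ?_
    have hi := homogeneousComponent_isHomogeneous i a
    rcases lt_or_ge d i with h | h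
    · rw [homogeneousComponent_mul_of_lt hi f h]
      exact (E d).zero_mem
    · obtain ⟨j, rfl⟩ := Nat.exists_eq_add_of_le h
      rw [homogeneousComponent_mul_add hi]
      exact (E _).mul_mem_left _ (hE (Nat.le_add_left j i) (hf j))

lemma homog_diagonalIdeal (hE : Monotone E) : Homog (diagonalIdeal E hE) := by
  refine isHomogeneous_iff_homogeneousComponent_mem.mpr fun f hf d e => ?_
  rw [homogeneousComponent_of_mem (homogeneousComponent_isHomogeneous d f)]
  split_ifs with h
  · exact h ▸ hf d
  · exact (E e).zero_mem

lemma component_diagonalIdeal (hE : Monotone E) (d : ℕ) :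
    component (diagonalIdeal E hE) d = component (E d) d := by
  ext f
  rw [mem_component, mem_component]
  refine and_congr_left fun hf => ⟨fun h => ?_, fun h e => ?_⟩
  · rw [← homogeneousComponent_eq_self hf]
    exact h d
  · rw [homogeneousComponent_of_mem hf]
    split_ifs with hed
    · rwa [hed]
    · exact (E e).zero_mem

/-- The ideal `⊕_j (Q_j)_{d + j}`. In degrees below `d` the sequence `e ↦ Q_{e - d}` is constantly
`Q_0`, and the intersection with `𝔪 ^ d` discards those degrees. -/
def familyIdeal (Q : ℕ → Ideal (MvPolynomial (Fin n) K)) (hQ : Monotone Q) (d : ℕ) :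
    Ideal (MvPolynomial (Fin n) K) :=
  diagonalIdeal (fun e => Q (e - d)) (hQ.comp fun _ _ h => Nat.sub_le_sub_right h d) ⊓
    idealOfVars (Fin n) K ^ d

variable (hQ : Monotone Q) (d : ℕ)

lemma homog_familyIdeal : Homog (familyIdeal Q hQ d) :=
  Ideal.IsHomogeneous.inf (homog_diagonalIdeal _) (isHomogeneous_pow_idealOfVars d)

lemma familyIdeal_le_pow : familyIdeal Q hQ d ≤ idealOfVars (Fin n) K ^ d :=
  inf_le_right

lemma component_familyIdeal_add (j : ℕ) :
    component (familyIdeal Q hQ d) (d + j) = component (Q j) (d + j) := by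
  have hdiag := component_diagonalIdeal (E := fun e => Q (e - d))
    (hQ.comp fun _ _ h => Nat.sub_le_sub_right h d) (d + j)
  rw [Nat.add_sub_cancel_left] at hdiag
  rw [← hdiag]
  refine le_antisymm (component_mono inf_le_left _) fun f hf => ?_
  obtain ⟨hfQ, hfd⟩ := mem_component.mp hf
  exact mem_component.mpr
    ⟨⟨hfQ, mem_pow_idealOfVars_of_isHomogeneous hfd (Nat.le_add_right d j)⟩, hfd⟩

lemma componentIdeal_familyIdeal_add (j : ℕ) :
    componentIdeal (familyIdeal Q hQ d) (d + j) = componentIdeal (Q j) (d + j) := by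
  rw [componentIdeal, component_familyIdeal_add, componentIdeal]

lemma restrictScalars_familyIdeal :
    (familyIdeal Q hQ d).restrictScalars K = ⨆ j : ℕ, component (Q j) (d + j) := by
  refine le_antisymm (fun f hf => ?_) (iSup_le fun j f hf => ?_)
  · rw [← sum_homogeneousComponent f]
    refine Submodule.sum_mem _ fun e _ => ?_
    have he := (homog_familyIdeal hQ d).homogeneousComponent_mem_component hf e
    rcases lt_or_ge e d with hed | hde
    · rw [component_eq_bot_of_le_pow (familyIdeal_le_pow hQ d) hed, Submodule.mem_bot] at he
      exact he ▸ Submodule.zero_mem _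
    · obtain ⟨j, rfl⟩ := Nat.exists_eq_add_of_le hde
      rw [component_familyIdeal_add] at he
      exact Submodule.mem_iSup_of_mem j he
  · rw [← component_familyIdeal_add hQ] at hf
    exact (mem_component.mp hf).1

variable {d}

lemma initialDegree_familyIdeal (h : component (Q 0) d ≠ ⊥) :
    initialDegree (familyIdeal Q hQ d) = d := by
  have hcomp : component (familyIdeal Q hQ d) d = component (Q 0) d :=
    component_familyIdeal_add hQ d 0
  exact initialDegree_eq (familyIdeal_le_pow hQ d) (hcomp ▸ h)

end FamilyIdeal

section Families

variable {K : Type*} [Field K] {n : ℕ} {Q : ℕ → Ideal (MvPolynomial (Fin n) K)} {d : ℕ}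

lemma monotone_of_mem_familiesA (hQ : Q ∈ familiesA K n) : Monotone Q :=
  monotone_nat_of_le_succ hQ.2.1

lemma saturation_eq_of_mem_familiesA (hQ : Q ∈ familiesA K n) (j : ℕ) :
    saturation (Q j) = Q j := by
  by_cases hj : Q j = ⊤
  · rw [hj]
    exact top_le_iff.mp (le_saturation ⊤)
  · exact (hQ.2.2.2 j hj).1

lemma exists_isRegularLinearForm_of_mem_familiesA [Infinite K] (hn : 2 ≤ n)
    (hQ : Q ∈ familiesA K n) :
    ∃ l, l ≠ 0 ∧ (∀ j, IsRegularLinearForm (Q j) l) ∧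
      ∀ j, idealOfVars (Fin n) K ^ regularity (Q 0) ≤ Q j ⊔ Ideal.span {l} := by
  have : NeZero n := ⟨by omega⟩
  obtain ⟨l, hl0, hl⟩ := exists_isRegularLinearForm (saturation_eq_of_mem_familiesA hQ 0)
  obtain ⟨s, hs⟩ : ∃ s, idealOfVars (Fin n) K ^ s ≤ Q 0 ⊔ Ideal.span {l} := by
    by_cases h0 : Q 0 = ⊤
    · exact ⟨0, h0 ▸ le_sup_of_le_left le_top⟩
    · exact hl.exists_pow_le_sup_span (hQ.1 0) (hQ.2.2.2 0 h0).2.le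
  have hreg := hl.pow_le_sup_span (hQ.1 0) hn (hl.isMumfordRegular (hQ.1 0) hs).regularity hs
  have hpow : ∀ j, idealOfVars (Fin n) K ^ regularity (Q 0) ≤ Q j ⊔ Ideal.span {l} := fun j =>
    hreg.trans (sup_le_sup_right (monotone_of_mem_familiesA hQ (Nat.zero_le j)) _)
  exact ⟨l, hl0, fun j => isRegularLinearForm_of_saturation_eq
    (saturation_eq_of_mem_familiesA hQ j) hl.isHomogeneous (hpow j), hpow⟩

lemma isMumfordRegular_of_mem_familiesA [Infinite K] (hn : 2 ≤ n) (hQ : Q ∈ familiesA K n)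
    (hd : regularity (Q 0) ≤ d) (j : ℕ) : IsMumfordRegular (Q j) d := by
  obtain ⟨l, -, hl, hpow⟩ := exists_isRegularLinearForm_of_mem_familiesA hn hQ
  exact ((hl j).isMumfordRegular (hQ.1 j) (hpow j)).mono hd

lemma component_ne_bot_of_mem_familiesA [Infinite K] (hn : 2 ≤ n) (hQ : Q ∈ familiesA K n)
    (hd : regularity (Q 0) ≤ d) (j : ℕ) : component (Q j) d ≠ ⊥ := by
  obtain ⟨l, -, hl, hpow⟩ := exists_isRegularLinearForm_of_mem_familiesA hn hQ
  exact component_ne_bot_of_pow_le_sup_span hn (hQ.1 j) (hl j).isHomogeneous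
    ((Ideal.pow_le_pow_right hd).trans (hpow j))

lemma satFamily_familyIdeal [Infinite K] (hn : 2 ≤ n) (hQ : Q ∈ familiesA K n)
    (hd : regularity (Q 0) ≤ d) :
    satFamily (familyIdeal Q (monotone_of_mem_familiesA hQ) d) = Q := by
  funext j
  rw [satFamily, initialDegree_familyIdeal _ (component_ne_bot_of_mem_familiesA hn hQ hd 0),
    componentIdeal_familyIdeal_add, IsMumfordRegular.saturation_componentIdeal
      (isMumfordRegular_of_mem_familiesA hn hQ (hd.trans (Nat.le_add_right d j)) j) (hQ.1 j),
    saturation_eq_of_mem_familiesA hQ]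

lemma finite_quotient_familyIdeal (hQ : Monotone Q) {N : ℕ} (hN : Q N = ⊤) :
    Module.Finite K (MvPolynomial (Fin n) K ⧸ familyIdeal Q hQ d) := by
  refine finite_of_pow_le (k := d + N) (pow_idealOfVars_le_iff.mpr fun f hf => ?_)
  refine (mem_component (d := d + N)).mp ?_ |>.1
  rw [component_familyIdeal_add, hN]
  exact mem_component.mpr ⟨Submodule.mem_top, hf⟩

lemma componentwiseLinear_familyIdeal [Infinite K] (hn : 2 ≤ n) (hQ : Q ∈ familiesA K n)
    (hd : regularity (Q 0) ≤ d) :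
    ComponentwiseLinear (familyIdeal Q (monotone_of_mem_familiesA hQ) d) := by
  intro e
  rcases lt_or_ge e d with hed | hde
  · exact Or.inl (componentIdeal_eq_bot (component_eq_bot_of_le_pow (familyIdeal_le_pow _ d) hed))
  · obtain ⟨j, rfl⟩ := Nat.exists_eq_add_of_le hde
    have hdj : regularity (Q 0) ≤ d + j := hd.trans hde
    rw [componentIdeal_familyIdeal_add]
    exact (hasLinearResolution_componentIdeal_iff
      (component_ne_bot_of_mem_familiesA hn hQ hdj j)).mpr
      (isMumfordRegular_of_mem_familiesA hn hQ hdj j).componentIdeal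

lemma familyIdeal_mem_classC [Infinite K] (hn : 2 ≤ n) (hQ : Q ∈ familiesA K n)
    (hd : regularity (Q 0) ≤ d) :
    familyIdeal Q (monotone_of_mem_familiesA hQ) d ∈ classC K n := by
  obtain ⟨l, hl0, hl, hpow⟩ := exists_isRegularLinearForm_of_mem_familiesA hn hQ
  obtain ⟨N, hN⟩ := hQ.2.2.1
  refine ⟨homog_familyIdeal _ d, finite_quotient_familyIdeal _ (hN N le_rfl),
    ⟨l, (hl 0).isHomogeneous, hl0, ?_⟩, componentwiseLinear_familyIdeal hn hQ hd⟩
  rw [initialDegree_familyIdeal _ (component_ne_bot_of_mem_familiesA hn hQ hd 0)]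
  refine le_antisymm (sup_le_sup_right (familyIdeal_le_pow _ d) _) (sup_le ?_ le_sup_right)
  exact (hQ.1 0).pow_le_sup_span_of_component_le (hl 0).isHomogeneous
    ((Ideal.pow_le_pow_right hd).trans (hpow 0))
    (component_familyIdeal_add (monotone_of_mem_familiesA hQ) d 0).ge

end Families

section ComponentwiseLinear

variable {K : Type*} [Field K] {n : ℕ} {I : Ideal (MvPolynomial (Fin n) K)}

lemma satFamily_le_succ (I : Ideal (MvPolynomial (Fin n) K)) (j : ℕ) :
    satFamily I j ≤ satFamily I (j + 1) := by
  refine (saturation_mono (Ideal.span_le.mpr fun f hf => ?_)).trans (saturation_saturation _).le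
  obtain ⟨hfI, hfd⟩ := mem_component.mp hf
  refine mem_saturation.mpr ⟨1, fun u hu => Ideal.subset_span (mem_component.mpr
    ⟨I.mul_mem_left u hfI, ?_⟩)⟩
  convert hu.mul hfd using 1
  ring

lemma homog_satFamily (I : Ideal (MvPolynomial (Fin n) K)) (j : ℕ) : Homog (satFamily I j) :=
  (homog_componentIdeal I _).saturation

lemma satFamily_eq_top {k j : ℕ} (h : idealOfVars (Fin n) K ^ k ≤ I) (hkj : k ≤ j) :
    satFamily I j = ⊤ :=
  saturation_eq_top (k := initialDegree I + j) <| pow_idealOfVars_le_iff.mpr fun _ hf =>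
    Ideal.subset_span (mem_component.mpr
      ⟨h (mem_pow_idealOfVars_of_isHomogeneous hf (hkj.trans (Nat.le_add_left j _))), hf⟩)

lemma exists_isRegularLinearForm_satFamily (hI : I ∈ classC K n) :
    ∃ l, (∀ j, IsRegularLinearForm (satFamily I j) l) ∧
      ∀ j, idealOfVars (Fin n) K ^ initialDegree I ≤ satFamily I j ⊔ Ideal.span {l} := by
  obtain ⟨hIhom, -, ⟨l, hl, -, hIl⟩, -⟩ := hI
  have hle : component I (initialDegree I) ≤ component (satFamily I 0) (initialDegree I) := by
    rw [← component_componentIdeal_self]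
    exact component_mono (le_saturation _) _
  have hpow : ∀ j, idealOfVars (Fin n) K ^ initialDegree I ≤ satFamily I j ⊔ Ideal.span {l} :=
    fun j => (hIhom.pow_le_sup_span_of_component_le hl (le_sup_left.trans hIl.ge) hle).trans
      (sup_le_sup_right (monotone_nat_of_le_succ (satFamily_le_succ I) (Nat.zero_le j)) _)
  exact ⟨l, fun j => isRegularLinearForm_of_saturation_eq (saturation_saturation _) hl (hpow j),
    hpow⟩

lemma satFamily_mem_familiesA (hI : I ∈ classC K n) : satFamily I ∈ familiesA K n := by
  obtain ⟨l, hl, hpow⟩ := exists_isRegularLinearForm_satFamily hI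
  have := hI.2.1
  obtain ⟨k, hk⟩ := hI.1.exists_pow_le_of_finite
  exact ⟨homog_satFamily I, satFamily_le_succ I, ⟨k, fun _ => satFamily_eq_top hk⟩, fun j hj =>
    ⟨saturation_saturation _, (hl j).ringKrullDim_eq_one (homog_satFamily I j) (hpow j) hj⟩⟩

lemma regularity_satFamily_le (hI : I ∈ classC K n) (j : ℕ) :
    regularity (satFamily I j) ≤ initialDegree I := by
  obtain ⟨l, hl, hpow⟩ := exists_isRegularLinearForm_satFamily hI
  exact ((hl j).isMumfordRegular (homog_satFamily I j) (hpow j)).regularity_le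

lemma component_initialDegree_ne_bot_of_mem_classC (hn : 2 ≤ n) (hI : I ∈ classC K n) :
    component I (initialDegree I) ≠ ⊥ := by
  obtain ⟨hIhom, -, ⟨l, hl, -, hIl⟩, -⟩ := hI
  exact component_ne_bot_of_pow_le_sup_span hn hIhom hl (le_sup_left.trans hIl.ge)

lemma component_satFamily (hn : 2 ≤ n) (hI : I ∈ classC K n) (j : ℕ) :
    component (satFamily I j) (initialDegree I + j) = component I (initialDegree I + j) := by
  have : NeZero n := ⟨by omega⟩
  have hreg := (hasLinearResolution_componentIdeal_iff (component_add_ne_bot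
    (component_initialDegree_ne_bot_of_mem_classC hn hI) j)).mp (hI.2.2.2 _)
  rw [satFamily, hreg.component_saturation le_rfl, component_componentIdeal_self]

lemma familyIdeal_satFamily (hn : 2 ≤ n) (hI : I ∈ classC K n) :
    familyIdeal (satFamily I) (monotone_of_mem_familiesA (satFamily_mem_familiesA hI))
      (initialDegree I) = I := by
  refine (homog_familyIdeal _ _).eq_of_component_eq hI.1 fun e => ?_
  rcases lt_or_ge e (initialDegree I) with he | he
  · rw [component_eq_bot_of_le_pow (familyIdeal_le_pow _ _) he]
    exact (not_not.mp (Nat.notMem_of_lt_sInf he)).symm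
  · obtain ⟨j, rfl⟩ := Nat.exists_eq_add_of_le he
    rw [component_familyIdeal_add, component_satFamily hn hI]

/-- The bijection between `𝒜 × ℕ` and `𝒞`: forwards `φ`, backwards `ψ`. The truncated subtraction
`o(I) - reg(Q_0(I))` in `ψ` is harmless by `regularity_satFamily_le`. -/
def familiesEquivClassC (K : Type*) [Field K] [Infinite K] (n : ℕ) (hn : 2 ≤ n) :
    (familiesA K n × ℕ) ≃ classC K n where
  toFun p := ⟨familyIdeal p.1 (monotone_of_mem_familiesA p.1.2) (regularity (p.1.1 0) + p.2),
    familyIdeal_mem_classC hn p.1.2 (Nat.le_add_right _ _)⟩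
  invFun I := (⟨satFamily I, satFamily_mem_familiesA I.2⟩,
    initialDegree I.1 - regularity (satFamily I.1 0))
  left_inv := by
    rintro ⟨⟨Q, hQ⟩, k⟩
    have hle := Nat.le_add_right (regularity (Q 0)) k
    refine Prod.ext (Subtype.ext (satFamily_familyIdeal hn hQ hle)) ?_
    simp only [satFamily_familyIdeal hn hQ hle, Nat.add_sub_cancel_left,
      initialDegree_familyIdeal _ (component_ne_bot_of_mem_familiesA hn hQ hle 0)]
  right_inv := by
    rintro ⟨I, hI⟩
    refine Subtype.ext ?_
    simp only [Nat.add_sub_cancel' (regularity_satFamily_le hI 0), familyIdeal_satFamily hn hI]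

end ComponentwiseLinear

end GradedIdeal

end

theorem mainTheorem8 (K : Type*) [Field K] [Infinite K] (n : ℕ) (hn : 2 ≤ n) :
    ∃ e : (GradedIdeal.familiesA K n × ℕ) ≃ GradedIdeal.classC K n,
      (∀ (Q : GradedIdeal.familiesA K n) (k : ℕ),
        (e (Q, k) : Ideal (MvPolynomial (Fin n) K)).restrictScalars K =
          GradedIdeal.gradedSum (Q : ℕ → Ideal (MvPolynomial (Fin n) K)) k) ∧
      (∀ I : GradedIdeal.classC K n,
        ((e.symm I).1 : ℕ → Ideal (MvPolynomial (Fin n) K)) = GradedIdeal.satFamily I.1 ∧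
        ((e.symm I).2 : ℤ) = (GradedIdeal.initialDegree I.1 : ℤ) -
          (GradedIdeal.regularity (GradedIdeal.satFamily I.1 0) : ℤ)) := by
  refine ⟨GradedIdeal.familiesEquivClassC K n hn, fun Q k => ?_, fun I => ⟨rfl, ?_⟩⟩
  · exact GradedIdeal.restrictScalars_familyIdeal (GradedIdeal.monotone_of_mem_familiesA Q.2) _
  · exact Nat.cast_sub (GradedIdeal.regularity_satFamily_le I.2 0)
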